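/- All manifolds are smooth, finite-dimensional and without boundary, and all maps, functions and Riemannian metrics are smooth. For Riemannian manifolds $(M_1,\tilde g_1)$, $(M_2,\tilde g_2)$ and positive functions $\rho_i : M_i\to\mathbb R$, the doubly warped product ${M_1}_{\rho_2}\!\times_{\rho_1} M_2$ is $M_1\times M_2$ with the Riemannian metric $$\tilde g=(\rho_2\circ\pi_2)^2\,\pi_1^*\tilde g_1+(\rho_1\circ\pi_1)^2\,\pi_2^*\tilde g_2 ,$$ where $\pi_i$ denotes the projection onto the $i$-th factor. Let $(N_i,g_i)$ and $(M_i,\tilde g_i)$, $i=1,2$, be Riemannian manifolds with $N_1,N_2$ non-empty, $n_i=\dim N_i$, let $\rho_i$ be a positive function on $M_i$, let $\phi_i:N_i\to M_i$ be isometric immersions, and put $f_i=\rho_i\circ\phi_i$. Consider the doubly warped product immersion $$\phi=(\phi_1,\phi_2):{N_1}_{f_2}\!\times_{f_1}N_2\to {M_1}_{\rho_2}\!\times_{\rho_1}M_2,\qquad \phi(x_1,x_2)=(\phi_1(x_1),\phi_2(x_2)).$$ Let $h$ be the second fundamental form of $\phi$, and $\|h\|^2=\sum_{a,b}\langle h(e_a,e_b),h(e_a,e_b)\rangle$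 for an orthonormal basis $(e_a)$ of the tangent space. Let $D\ln\rho_i$ be the component normal to $\phi$ of the gradient, with respect to $\tilde g$, of $\ln\rho_i\circ\pi_i$ on $M_1\times M_2$, restricted to $N_1\times N_2$; its norm is taken with respect to $\tilde g$. Let $\mathcal D_i$ be the distribution on $N_1\times N_2$ of vectors tangent to the factor $N_i$. The map $\phi$ is called mixed totally geodesic if $h(X,Z)=0$ for all $X\in\mathcal D_1$, $Z\in\mathcal D_2$; $N_i$-totally geodesic if $h$ vanishes on $\mathcal D_i\times\mathcal D_i$; and an isometric immersion is called totally geodesic if its second fundamental form vanishes identically. Then: 1. $\phi$ is mixed totally geodesic. 2. At every point, $\|h\|^2\ge n_1\|D\ln\rho_2\|^2+n_2\|D\ln\rho_1\|^2$. Equality holds at every point of $N_1\times N_2$ if and only if $\phi_1:(N_1,g_1)\to (M_1,\tilde g_1)$ and $\phi_2:(N_2,g_2)\to (M_2,\tilde g_2)$ are both totally geodesic. 3. For $\{i,j\}=\{1,2\}$ with $n_i\ge 1$: $\phi$ is $N_i$-totally geodesic if and only if $\phi_i$ is totally geodesic and $D\ln\rho_j=0$ on $N_1\times N_2$. 4.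 $\phi$ is totally geodesic if and only if it is both $N_1$-totally geodesic and $N_2$-totally geodesic. -/

import Mathlib

open scoped Manifold ContDiff Topology

noncomputable section

namespace DWP

section LinearAlgebra

variable {V : Type*} [AddCommGroup V] [Module ℝ V] [FiniteDimensional ℝ V]

/-- Riesz representation for a positive definite bilinear form on a finite dimensional space. -/
theorem exists_riesz (b : V →ₗ[ℝ] V →ₗ[ℝ] ℝ) (pos : ∀ v, v ≠ 0 → 0 < b v v)
    (α : V →ₗ[ℝ] ℝ) : ∃ v, ∀ w, b v w = α w := by
  have hinj : Function.Injective b := by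
    rw [← LinearMap.ker_eq_bot, LinearMap.ker_eq_bot']
    intro v hv
    by_contra h
    have := pos v h
    simp [hv] at this
  have hsurj : Function.Surjective b :=
    (LinearMap.injective_iff_surjective_of_finrank_eq_finrank
      (Subspace.dual_finrank_eq (K := ℝ) (V := V)).symm).1 hinj
  obtain ⟨v, hv⟩ := hsurj α
  exact ⟨v, fun w => by rw [hv]⟩

/-- Orthogonal decomposition with respect to a subspace. -/
theorem exists_normal (b : V →ₗ[ℝ] V →ₗ[ℝ] ℝ) (pos : ∀ v, v ≠ 0 → 0 < b v v)
    (W : Submodule ℝ V) (v : V) : ∃ n, (∀ w ∈ W, b n w = 0) ∧ v - n ∈ W := by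
  obtain ⟨u, hu⟩ := exists_riesz (V := W) (b.domRestrict₁₂ W W)
    (fun w hw => pos w (by simpa using hw)) ((b v).domRestrict W)
  refine ⟨v - u, fun w hw => ?_, by simp⟩
  have := hu ⟨w, hw⟩
  rw [LinearMap.domRestrict₁₂_apply, LinearMap.domRestrict_apply] at this
  rw [map_sub, LinearMap.sub_apply, sub_eq_zero]
  exact this.symm

theorem exists_orthonormal (b : V →ₗ[ℝ] V →ₗ[ℝ] ℝ) (symm : ∀ v w, b v w = b w v)
    (pos : ∀ v, v ≠ 0 → 0 < b v v) :
    ∃ e : Fin (Module.finrank ℝ V) → V, ∀ i j, b (e i) (e j) = if i = j then 1 else 0 := by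
  let c : InnerProductSpace.Core ℝ V :=
    { inner := fun v w => b v w
      conj_inner_symm := fun v w => by simpa using symm w v
      re_inner_nonneg := fun v => by
        rcases eq_or_ne v 0 with rfl | h
        · simp
        · simpa using (pos v h).le
      add_left := fun u v w => by simp
      smul_left := fun u v r => by simp
      definite := fun v hv => by
        by_contra h
        exact (pos v h).ne' hv }
  let := c.toNormedAddCommGroup
  let : InnerProductSpace ℝ V := InnerProductSpace.ofCore c.toCore
  refine ⟨stdOrthonormalBasis ℝ V, fun i j => ?_⟩
  exact orthonormal_iff_ite.1 (stdOrthonormalBasis ℝ V).orthonormal i j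

end LinearAlgebra

section Riemannian

set_option linter.unusedSectionVars false

variable {E : Type*} [NormedAddCommGroup E] [NormedSpace ℝ E] [FiniteDimensional ℝ E]
  {H : Type*} [TopologicalSpace H] {I : ModelWithCorners ℝ E H}
  {M : Type*} [TopologicalSpace M] [ChartedSpace H M] [IsManifold I ∞ M]
  {E' : Type*} [NormedAddCommGroup E'] [NormedSpace ℝ E'] [FiniteDimensional ℝ E']
  {H' : Type*} [TopologicalSpace H'] {I' : ModelWithCorners ℝ E' H'}
  {M' : Type*} [TopologicalSpace M'] [ChartedSpace H' M'] [IsManifold I' ∞ M']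

variable (I M) in
/-- A smooth Riemannian metric on the manifold `M`. -/
abbrev Metric := Bundle.ContMDiffRiemannianMetric I ∞ E (fun p : M => TangentSpace I p)

/-- The inner product of `g` at `p` as a bilinear form. -/
def Metric.form (g : Metric I M) (p : M) :
    TangentSpace I p →ₗ[ℝ] TangentSpace I p →ₗ[ℝ] ℝ :=
  LinearMap.mk₂ ℝ (fun v w => g.inner p v w) (by simp) (by simp) (by simp) (by simp)

theorem Metric.exists_sharp (g : Metric I M) (p : M) (α : TangentSpace I p →L[ℝ] ℝ) :
    ∃ v : TangentSpace I p, ∀ w, g.inner p v w = α w :=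
  have : FiniteDimensional ℝ (TangentSpace I p) := inferInstanceAs (FiniteDimensional ℝ E)
  exists_riesz (g.form p) (g.pos p) α.toLinearMap

/-- The tangent vector dual to the covector `α`, i.e. `g (sharp α) w = α w`. -/
def Metric.sharp (g : Metric I M) (p : M) (α : TangentSpace I p →L[ℝ] ℝ) : TangentSpace I p :=
  (g.exists_sharp p α).choose

/-- The gradient of a function. -/
def Metric.grad (g : Metric I M) (F : M → ℝ) (p : M) : TangentSpace I p :=
  g.sharp p (mfderiv I 𝓘(ℝ, ℝ) F p)

/-- The metric coefficients in the preferred chart around `p`, at the coordinate point `y`: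
the pull back of `g` under the inverse chart. -/
def Metric.coeff (g : Metric I M) (p : M) (y : E) : E →L[ℝ] E →L[ℝ] ℝ :=
  let x : M := (extChartAt I p).symm y
  let A : E →L[ℝ] TangentSpace I x := mfderiv 𝓘(ℝ, E) I (extChartAt I p).symm y
  ((ContinuousLinearMap.precomp ℝ A).comp (g.inner x)).comp A

/-- The Christoffel map `Γ(X, Y)` at `p` of the Levi-Civita connection of `g`, in the preferred
chart around `p` (in which `TangentSpace I p` is identified with `E`). With `G` the coefficients of
`g` in the chart, it is characterised by
`2 g (Γ(X, Y), Z) = (∂_X G)(Y, Z) + (∂_Y G)(X, Z) - (∂_Z G)(X, Y)`. -/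
def Metric.christoffel (g : Metric I M) (p : M) (X Y : TangentSpace I p) : TangentSpace I p :=
  let dG := fderiv ℝ (g.coeff p) (extChartAt I p p)
  let X' : E := X
  let Y' : E := Y
  let α : E →L[ℝ] ℝ := (1 / 2 : ℝ) • (dG X' Y' + dG Y' X' - (dG.flip X').flip Y')
  g.sharp p α

/-- Isometric immersions. As the metrics are positive definite, the differential is
injective. -/
structure IsIsometricImmersion (g : Metric I M) (g' : Metric I' M') (φ : M → M') : Prop where
  contMDiff : ContMDiff I I' ∞ φ
  isometric : ∀ (p : M) (X Y : TangentSpace I p),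
    g'.inner (φ p) (mfderiv I I' φ p X) (mfderiv I I' φ p Y) = g.inner p X Y

variable (I) in
theorem Metric.exists_normalPart (g' : Metric I' M') (φ : M → M') (p : M)
    (v : TangentSpace I' (φ p)) :
    ∃ n : TangentSpace I' (φ p),
      (∀ X : TangentSpace I p, g'.inner (φ p) n (mfderiv I I' φ p X) = 0) ∧
      ∃ X : TangentSpace I p, v - n = mfderiv I I' φ p X := by
  have : FiniteDimensional ℝ (TangentSpace I' (φ p)) := inferInstanceAs (FiniteDimensional ℝ E')
  obtain ⟨n, h, h'⟩ := exists_normal (g'.form (φ p)) (g'.pos (φ p))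
    (LinearMap.range (mfderiv I I' φ p).toLinearMap) v
  obtain ⟨X, hX⟩ := h'
  exact ⟨n, fun X => h _ ⟨X, rfl⟩, X, hX.symm⟩

variable (I) in
/-- The component of `v ∈ T_{φ p} M'` normal to the image of `dφ_p`: the vector `n` orthogonal to
this image for which `v - n` lies in it. -/
def Metric.normalPart (g' : Metric I' M') (φ : M → M') (p : M) (v : TangentSpace I' (φ p)) :
    TangentSpace I' (φ p) :=
  (g'.exists_normalPart I φ p v).choose

variable (I) in
/-- `D F`: the normal component of the gradient of `F : M' → ℝ` along the immersion `φ`. -/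
def Metric.normalGrad (g' : Metric I' M') (φ : M → M') (F : M' → ℝ) (p : M) :
    TangentSpace I' (φ p) :=
  g'.normalPart I φ p (g'.grad F (φ p))

variable (I) in
/-- The second fundamental form `h(X, Y)` at `p` of the immersion `φ` into `(M', g')`: the normal
component of the ambient Levi-Civita derivative `∇_X dφ(Y)`, where `Y` is extended to the vector
field with constant coefficients in the preferred chart around `p`. In the preferred charts around
`p` and `φ p`, that derivative is `∂_X ∂_Y φ + Γ'(dφ X, dφ Y)`. -/
def Metric.secondForm (g' : Metric I' M') (φ : M → M') (p : M) (X Y : TangentSpace I p) :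
    TangentSpace I' (φ p) :=
  let Φ : E → E' := writtenInExtChartAt I I' p φ
  let X' : E := X
  let Y' : E := Y
  let D : E' := fderiv ℝ (fderiv ℝ Φ) (extChartAt I p p) X' Y'
  let D' : TangentSpace I' (φ p) := D
  g'.normalPart I φ p
    (D' + g'.christoffel (φ p) (mfderiv I I' φ p X) (mfderiv I I' φ p Y))

variable (I) in
/-- `φ` is totally geodesic: its second fundamental form vanishes identically. -/
def Metric.IsTotallyGeodesic (g' : Metric I' M') (φ : M → M') : Prop :=
  ∀ (p : M) (X Y : TangentSpace I p), g'.secondForm I φ p X Y = 0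

/-- The squared norm `g(v, v)`. -/
def Metric.normSq (g : Metric I M) (p : M) (v : TangentSpace I p) : ℝ := g.inner p v v

theorem Metric.exists_orthonormalBasis (g : Metric I M) (p : M) :
    ∃ e : Fin (Module.finrank ℝ E) → TangentSpace I p,
      ∀ i j, g.inner p (e i) (e j) = if i = j then 1 else 0 :=
  have : FiniteDimensional ℝ (TangentSpace I p) := inferInstanceAs (FiniteDimensional ℝ E)
  exists_orthonormal (g.form p) (g.symm p) (g.pos p)

/-- An orthonormal basis of the tangent space at `p`. -/
def Metric.orthonormalBasis (g : Metric I M) (p : M) :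
    Fin (Module.finrank ℝ E) → TangentSpace I p :=
  (g.exists_orthonormalBasis p).choose

/-- The squared norm `‖h‖² = ∑ ⟨h(e_a, e_b), h(e_a, e_b)⟩` at `p` of the second fundamental form of
`φ : (M, g) → (M', g')`, over an orthonormal basis (the sum does not depend on the basis). -/
def secondFormNormSq (g : Metric I M) (g' : Metric I' M') (φ : M → M') (p : M) : ℝ :=
  ∑ a, ∑ b, g'.normSq (φ p)
    (g'.secondForm I φ p (g.orthonormalBasis p a) (g.orthonormalBasis p b))

variable (I M) in
/-- A positive smooth function. -/
structure WarpingFunction where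
  toFun : M → ℝ
  contMDiff : ContMDiff I 𝓘(ℝ, ℝ) ∞ toFun
  pos : ∀ p, 0 < toFun p

/-- The pull back `ρ ∘ φ` of a positive smooth function. -/
def WarpingFunction.comp (ρ : WarpingFunction I' M') (φ : M → M') (hφ : ContMDiff I I' ∞ φ) :
    WarpingFunction I M where
  toFun := ρ.toFun ∘ φ
  contMDiff := ρ.contMDiff.comp hφ
  pos p := ρ.pos (φ p)

end Riemannian

section DoublyWarped

set_option linter.unusedSectionVars false

variable {E₁ : Type*} [NormedAddCommGroup E₁] [NormedSpace ℝ E₁] [FiniteDimensional ℝ E₁]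
  {H₁ : Type*} [TopologicalSpace H₁] {I₁ : ModelWithCorners ℝ E₁ H₁}
  {M₁ : Type*} [TopologicalSpace M₁] [ChartedSpace H₁ M₁] [IsManifold I₁ ∞ M₁]
  {E₂ : Type*} [NormedAddCommGroup E₂] [NormedSpace ℝ E₂] [FiniteDimensional ℝ E₂]
  {H₂ : Type*} [TopologicalSpace H₂] {I₂ : ModelWithCorners ℝ E₂ H₂}
  {M₂ : Type*} [TopologicalSpace M₂] [ChartedSpace H₂ M₂] [IsManifold I₂ ∞ M₂]

/-- The bilinear form `a² B₁ ⊕ b² B₂` on a product. -/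
def warpedForm (a b : ℝ) (B₁ : E₁ →L[ℝ] E₁ →L[ℝ] ℝ) (B₂ : E₂ →L[ℝ] E₂ →L[ℝ] ℝ) :
    (E₁ × E₂) →L[ℝ] (E₁ × E₂) →L[ℝ] ℝ :=
  a ^ 2 • (((ContinuousLinearMap.fst ℝ E₁ E₂).precomp ℝ).comp B₁).comp
      (ContinuousLinearMap.fst ℝ E₁ E₂) +
    b ^ 2 • (((ContinuousLinearMap.snd ℝ E₁ E₂).precomp ℝ).comp B₂).comp
      (ContinuousLinearMap.snd ℝ E₁ E₂)

theorem warpedForm_apply (a b : ℝ) (B₁ : E₁ →L[ℝ] E₁ →L[ℝ] ℝ) (B₂ : E₂ →L[ℝ] E₂ →L[ℝ] ℝ)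
    (v w : E₁ × E₂) :
    warpedForm a b B₁ B₂ v w = a ^ 2 * B₁ v.1 w.1 + b ^ 2 * B₂ v.2 w.2 := by
  simp [warpedForm]

/-- The tangent vector of `M₁ × M₂` with components `a` and `b`, under the identification
`T_x (M₁ × M₂) = T_{x₁} M₁ × T_{x₂} M₂`. -/
def tangentPair {x : M₁ × M₂} (a : TangentSpace I₁ x.1) (b : TangentSpace I₂ x.2) :
    TangentSpace (I₁.prod I₂) x :=
  Prod.mk (α := E₁) (β := E₂) a b

theorem exists_tangentPair {x : M₁ × M₂} (v : TangentSpace (I₁.prod I₂) x) :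
    ∃ (a : TangentSpace I₁ x.1) (b : TangentSpace I₂ x.2), v = tangentPair a b :=
  ⟨Prod.fst (α := E₁) (β := E₂) v, Prod.snd (α := E₁) (β := E₂) v, rfl⟩

theorem trivializationAt_inner_apply {x₀ x : M₁}
    (B : TangentSpace I₁ x →L[ℝ] TangentSpace I₁ x →L[ℝ] ℝ)
    (hx : x ∈ (chartAt H₁ x₀).source) (v w : E₁) :
    (trivializationAt (E₁ →L[ℝ] E₁ →L[ℝ] ℝ)
        (fun p : M₁ => TangentSpace I₁ p →L[ℝ] TangentSpace I₁ p →L[ℝ] ℝ) x₀ ⟨x, B⟩).2 v w =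
      B ((trivializationAt E₁ (TangentSpace I₁) x₀).symmL ℝ x v)
        ((trivializationAt E₁ (TangentSpace I₁) x₀).symmL ℝ x w) := by
  rw [hom_trivializationAt_apply]
  rw [inCoordinates_apply_eq₂ (by simpa using hx) (by simpa using hx) (Set.mem_univ _)]
  rw [Bundle.Trivialization.symmL_apply _ (by simpa using hx),
    Bundle.Trivialization.symmL_apply _ (by simpa using hx)]
  simp

theorem symmL_prod {x₀ x : M₁ × M₂} (hx : x.1 ∈ (chartAt H₁ x₀.1).source)
    (hx' : x.2 ∈ (chartAt H₂ x₀.2).source) (v : E₁ × E₂) :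
    (trivializationAt (E₁ × E₂) (TangentSpace (I₁.prod I₂)) x₀).symmL ℝ x v =
      tangentPair ((trivializationAt E₁ (TangentSpace I₁) x₀.1).symmL ℝ x.1 v.1)
        ((trivializationAt E₂ (TangentSpace I₂) x₀.2).symmL ℝ x.2 v.2) := by
  have h : x ∈ (chartAt (ModelProd H₁ H₂) x₀).source := by
    rw [prodChartedSpace_chartAt]; exact ⟨hx, hx'⟩
  have : IsManifold I₁ 1 M₁ := IsManifold.of_le (n := ∞) (by simp)
  have : IsManifold I₂ 1 M₂ := IsManifold.of_le (n := ∞) (by simp)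
  rw [TangentBundle.symmL_trivializationAt h, TangentBundle.symmL_trivializationAt hx,
    TangentBundle.symmL_trivializationAt hx']
  have d₁ : MDifferentiableWithinAt 𝓘(ℝ, E₁) I₁ (extChartAt I₁ x₀.1).symm (Set.range I₁)
      (extChartAt I₁ x₀.1 x.1) :=
    mdifferentiableWithinAt_extChartAt_symm
      ((extChartAt I₁ x₀.1).map_source (by simpa using hx))
  have d₂ : MDifferentiableWithinAt 𝓘(ℝ, E₂) I₂ (extChartAt I₂ x₀.2).symm (Set.range I₂)
      (extChartAt I₂ x₀.2 x.2) :=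
    mdifferentiableWithinAt_extChartAt_symm
      ((extChartAt I₂ x₀.2).map_source (by simpa using hx'))
  have key := mfderivWithin_prodMap (p := (extChartAt I₁ x₀.1 x.1, extChartAt I₂ x₀.2 x.2)) d₁ d₂
    (I₁.uniqueDiffOn.uniqueMDiffOn _ (by simp)) (I₂.uniqueDiffOn.uniqueMDiffOn _ (by simp))
  rw [extChartAt_prod, modelWithCorners_prod_coe, Set.range_prodMap, modelWithCornersSelf_prod,
    ← chartedSpaceSelf_prod]
  exact congrArg (fun L : E₁ × E₂ →L[ℝ] E₁ × E₂ => L v) key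

/-- The bilinear form `(f₂ ∘ π₂)² π₁^* g₁ + (f₁ ∘ π₁)² π₂^* g₂` on `M₁ × M₂`. -/
def warpedInner (g₁ : Metric I₁ M₁) (g₂ : Metric I₂ M₂) (f₁ : WarpingFunction I₁ M₁)
    (f₂ : WarpingFunction I₂ M₂) (x : M₁ × M₂) :
    TangentSpace (I₁.prod I₂) x →L[ℝ] TangentSpace (I₁.prod I₂) x →L[ℝ] ℝ :=
  let B₁ : E₁ →L[ℝ] E₁ →L[ℝ] ℝ := g₁.inner x.1
  let B₂ : E₂ →L[ℝ] E₂ →L[ℝ] ℝ := g₂.inner x.2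
  warpedForm (f₂.toFun x.2) (f₁.toFun x.1) B₁ B₂

theorem warpedInner_apply (g₁ : Metric I₁ M₁) (g₂ : Metric I₂ M₂) (f₁ : WarpingFunction I₁ M₁)
    (f₂ : WarpingFunction I₂ M₂) (x : M₁ × M₂) (a c : TangentSpace I₁ x.1)
    (b d : TangentSpace I₂ x.2) :
    warpedInner g₁ g₂ f₁ f₂ x (tangentPair a b) (tangentPair c d) =
      f₂.toFun x.2 ^ 2 * g₁.inner x.1 a c + f₁.toFun x.1 ^ 2 * g₂.inner x.2 b d :=
  warpedForm_apply _ _ _ _ _ _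

theorem warpedInner_pos (g₁ : Metric I₁ M₁) (g₂ : Metric I₂ M₂) (f₁ : WarpingFunction I₁ M₁)
    (f₂ : WarpingFunction I₂ M₂) (x : M₁ × M₂) (v : TangentSpace (I₁.prod I₂) x) (hv : v ≠ 0) :
    0 < warpedInner g₁ g₂ f₁ f₂ x v v := by
  obtain ⟨a, b, rfl⟩ := exists_tangentPair v
  have h₁ := sq_pos_of_pos (f₁.pos x.1)
  have h₂ := sq_pos_of_pos (f₂.pos x.2)
  rw [warpedInner_apply]
  have ha : 0 ≤ g₁.inner x.1 a a := by
    rcases eq_or_ne a 0 with h | h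
    · simp [h]
    · exact (g₁.pos x.1 a h).le
  have hb : 0 ≤ g₂.inner x.2 b b := by
    rcases eq_or_ne b 0 with h | h
    · simp [h]
    · exact (g₂.pos x.2 b h).le
  by_cases h : a = 0
  · have hb' : b ≠ 0 := fun h' => hv (Prod.ext h h')
    have := g₂.pos x.2 b hb'
    positivity
  · have := g₁.pos x.1 a h
    positivity

theorem warpedInner_symm (g₁ : Metric I₁ M₁) (g₂ : Metric I₂ M₂) (f₁ : WarpingFunction I₁ M₁)
    (f₂ : WarpingFunction I₂ M₂) (x : M₁ × M₂) (v w : TangentSpace (I₁.prod I₂) x) :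
    warpedInner g₁ g₂ f₁ f₂ x v w = warpedInner g₁ g₂ f₁ f₂ x w v := by
  obtain ⟨a, b, rfl⟩ := exists_tangentPair v
  obtain ⟨c, d, rfl⟩ := exists_tangentPair w
  rw [warpedInner_apply, warpedInner_apply, g₁.symm x.1 a c, g₂.symm x.2 b d]

theorem isVonNBounded_of_pos {V : Type*} [NormedAddCommGroup V] [NormedSpace ℝ V]
    [FiniteDimensional ℝ V] (B : V →L[ℝ] V →L[ℝ] ℝ) (pos : ∀ v, v ≠ 0 → 0 < B v v) :
    Bornology.IsVonNBounded ℝ {v | B v v < 1} := by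
  rw [NormedSpace.isVonNBounded_iff]
  obtain ⟨c, hc, h⟩ : ∃ c : ℝ, 0 < c ∧ ∀ v, c * ‖v‖ ^ 2 ≤ B v v := by
    rcases subsingleton_or_nontrivial V with hV | hV
    · exact ⟨1, one_pos, fun v => by simp [Subsingleton.elim v 0]⟩
    obtain ⟨u, hu, hmin⟩ := (isCompact_sphere (0 : V) 1).exists_isMinOn
      (NormedSpace.sphere_nonempty.2 zero_le_one)
      (f := fun v => B v v) (by fun_prop)
    have hu0 : u ≠ 0 := by
      rintro rfl
      simp at hu
    refine ⟨B u u, pos u hu0, fun v => ?_⟩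
    rcases eq_or_ne v 0 with rfl | hv
    · simp
    have hn : 0 < ‖v‖ := norm_pos_iff.2 hv
    have hm : B u u ≤ B (‖v‖⁻¹ • v) (‖v‖⁻¹ • v) :=
      hmin (by simp [norm_smul, hn.ne'])
    calc B u u * ‖v‖ ^ 2 ≤ B (‖v‖⁻¹ • v) (‖v‖⁻¹ • v) * ‖v‖ ^ 2 := by gcongr
      _ = B v v := by
        simp only [map_smul, smul_eq_mul, _root_.smul_apply]
        field_simp
  rw [isBounded_iff_forall_norm_le]
  refine ⟨1 + 1 / c, fun v hv => ?_⟩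
  have h' : c * ‖v‖ ^ 2 < 1 := lt_of_le_of_lt (h v) hv
  have : ‖v‖ ^ 2 < 1 / c := by rwa [lt_div_iff₀ hc, mul_comm]
  nlinarith [norm_nonneg v, sq_nonneg (‖v‖ - 1)]

theorem contDiff_sq_smul_add {X F : Type*} [NormedAddCommGroup X] [NormedSpace ℝ X]
    [NormedAddCommGroup F] [NormedSpace ℝ F] {a b : X → ℝ} {u v : X → F} (ha : ContDiff ℝ ∞ a)
    (hb : ContDiff ℝ ∞ b) (hu : ContDiff ℝ ∞ u) (hv : ContDiff ℝ ∞ v) :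
    ContDiff ℝ ∞ (fun q => a q ^ 2 • u q + b q ^ 2 • v q) :=
  ((ha.pow 2).smul hu).add ((hb.pow 2).smul hv)

theorem contDiff_warpedForm : ContDiff ℝ ∞
    (fun q : ℝ × ℝ × (E₁ →L[ℝ] E₁ →L[ℝ] ℝ) × (E₂ →L[ℝ] E₂ →L[ℝ] ℝ) =>
      warpedForm q.1 q.2.1 q.2.2.1 q.2.2.2) := by
  have h₁ : ContDiff ℝ ∞ (fun q : ℝ × ℝ × (E₁ →L[ℝ] E₁ →L[ℝ] ℝ) × (E₂ →L[ℝ] E₂ →L[ℝ] ℝ) =>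
      (((ContinuousLinearMap.fst ℝ E₁ E₂).precomp ℝ).comp q.2.2.1).comp
        (ContinuousLinearMap.fst ℝ E₁ E₂)) :=
    (contDiff_const.clm_comp (by fun_prop)).clm_comp contDiff_const
  have h₂ : ContDiff ℝ ∞ (fun q : ℝ × ℝ × (E₁ →L[ℝ] E₁ →L[ℝ] ℝ) × (E₂ →L[ℝ] E₂ →L[ℝ] ℝ) =>
      (((ContinuousLinearMap.snd ℝ E₁ E₂).precomp ℝ).comp q.2.2.2).comp
        (ContinuousLinearMap.snd ℝ E₁ E₂)) :=
    (contDiff_const.clm_comp (by fun_prop)).clm_comp contDiff_const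
  exact contDiff_sq_smul_add contDiff_fst contDiff_snd.fst h₁ h₂

theorem contMDiff_warpedInner (g₁ : Metric I₁ M₁) (g₂ : Metric I₂ M₂)
    (f₁ : WarpingFunction I₁ M₁) (f₂ : WarpingFunction I₂ M₂) :
    ContMDiff (I₁.prod I₂)
      ((I₁.prod I₂).prod 𝓘(ℝ, (E₁ × E₂) →L[ℝ] (E₁ × E₂) →L[ℝ] ℝ)) ∞
      (fun x : M₁ × M₂ => Bundle.TotalSpace.mk' ((E₁ × E₂) →L[ℝ] (E₁ × E₂) →L[ℝ] ℝ)
        (E := fun p : M₁ × M₂ =>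
          TangentSpace (I₁.prod I₂) p →L[ℝ] TangentSpace (I₁.prod I₂) p →L[ℝ] ℝ) x
        (warpedInner g₁ g₂ f₁ f₂ x)) := by
  intro x₀
  rw [Bundle.contMDiffAt_section]
  have c₁ := (Bundle.contMDiffAt_section x₀.1).1 (g₁.contMDiff x₀.1)
  have c₂ := (Bundle.contMDiffAt_section x₀.2).1 (g₂.contMDiff x₀.2)
  have c₁' := c₁.comp x₀ (contMDiffAt_fst (I := I₁) (J := I₂))
  have c₂' := c₂.comp x₀ (contMDiffAt_snd (I := I₁) (J := I₂))
  have k₁ := (f₁.contMDiff x₀.1).comp x₀ (contMDiffAt_fst (I := I₁) (J := I₂))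
  have k₂ := (f₂.contMDiff x₀.2).comp x₀ (contMDiffAt_snd (I := I₁) (J := I₂))
  have key : ContMDiffAt (I₁.prod I₂) 𝓘(ℝ, (E₁ × E₂) →L[ℝ] (E₁ × E₂) →L[ℝ] ℝ) ∞
      (fun x : M₁ × M₂ => warpedForm (f₂.toFun x.2) (f₁.toFun x.1)
        (trivializationAt (E₁ →L[ℝ] E₁ →L[ℝ] ℝ)
          (fun p : M₁ => TangentSpace I₁ p →L[ℝ] TangentSpace I₁ p →L[ℝ] ℝ) x₀.1
          ⟨x.1, g₁.inner x.1⟩).2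
        (trivializationAt (E₂ →L[ℝ] E₂ →L[ℝ] ℝ)
          (fun p : M₂ => TangentSpace I₂ p →L[ℝ] TangentSpace I₂ p →L[ℝ] ℝ) x₀.2
          ⟨x.2, g₂.inner x.2⟩).2) x₀ := by
    exact (contDiff_warpedForm (E₁ := E₁) (E₂ := E₂)).contMDiff.contMDiffAt.comp x₀
      (k₂.prodMk_space (k₁.prodMk_space (c₁'.prodMk_space c₂')))
  refine key.congr_of_eventuallyEq ?_
  have n₁ : ∀ᶠ x in 𝓝 x₀, x.1 ∈ (chartAt H₁ x₀.1).source :=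
    continuous_fst.continuousAt.eventually
      ((chartAt H₁ x₀.1).open_source.mem_nhds (mem_chart_source _ _))
  have n₂ : ∀ᶠ x in 𝓝 x₀, x.2 ∈ (chartAt H₂ x₀.2).source :=
    continuous_snd.continuousAt.eventually
      ((chartAt H₂ x₀.2).open_source.mem_nhds (mem_chart_source _ _))
  filter_upwards [n₁, n₂] with x h₁ h₂
  refine ContinuousLinearMap.ext (fun v : E₁ × E₂ => ContinuousLinearMap.ext
    (fun w : E₁ × E₂ => ?_))
  have h : x ∈ (chartAt (ModelProd H₁ H₂) x₀).source := by
    rw [prodChartedSpace_chartAt]; exact ⟨h₁, h₂⟩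
  rw [warpedForm_apply]
  rw [trivializationAt_inner_apply _ h₁]
  rw [trivializationAt_inner_apply _ h₂]
  refine (trivializationAt_inner_apply (I₁ := I₁.prod I₂) _ h v w).trans ?_
  rw [symmL_prod h₁ h₂, symmL_prod h₁ h₂]
  exact warpedInner_apply ..

/-- The doubly warped product metric `(f₂ ∘ π₂)² π₁^* g₁ + (f₁ ∘ π₁)² π₂^* g₂` on `M₁ × M₂`. -/
def doublyWarpedMetric (g₁ : Metric I₁ M₁) (g₂ : Metric I₂ M₂) (f₁ : WarpingFunction I₁ M₁)
    (f₂ : WarpingFunction I₂ M₂) : Metric (I₁.prod I₂) (M₁ × M₂) where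
  inner := warpedInner g₁ g₂ f₁ f₂
  symm := warpedInner_symm g₁ g₂ f₁ f₂
  pos := warpedInner_pos g₁ g₂ f₁ f₂
  isVonNBounded x := isVonNBounded_of_pos (V := E₁ × E₂) (warpedInner g₁ g₂ f₁ f₂ x)
    (warpedInner_pos g₁ g₂ f₁ f₂ x)
  contMDiff := contMDiff_warpedInner g₁ g₂ f₁ f₂

variable {E' : Type*} [NormedAddCommGroup E'] [NormedSpace ℝ E'] [FiniteDimensional ℝ E']
  {H' : Type*} [TopologicalSpace H'] {I' : ModelWithCorners ℝ E' H'}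
  {M' : Type*} [TopologicalSpace M'] [ChartedSpace H' M'] [IsManifold I' ∞ M']

variable (I₁ I₂) in
/-- `φ : M₁ × M₂ → M'` is mixed totally geodesic: `h(X, Z) = 0` for `X` tangent to `M₁` and `Z`
tangent to `M₂`. -/
def Metric.IsMixedTotallyGeodesic (g' : Metric I' M') (φ : M₁ × M₂ → M') : Prop :=
  ∀ (x : M₁ × M₂) (X : TangentSpace I₁ x.1) (Z : TangentSpace I₂ x.2),
    g'.secondForm (I₁.prod I₂) φ x (tangentPair X 0) (tangentPair 0 Z) = 0

variable (I₁ I₂) in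
/-- `φ : M₁ × M₂ → M'` is `M₁`-totally geodesic: `h(X, Y) = 0` for `X`, `Y` tangent to `M₁`. -/
def Metric.IsFirstTotallyGeodesic (g' : Metric I' M') (φ : M₁ × M₂ → M') : Prop :=
  ∀ (x : M₁ × M₂) (X Y : TangentSpace I₁ x.1),
    g'.secondForm (I₁.prod I₂) φ x (tangentPair X 0) (tangentPair Y 0) = 0

variable (I₁ I₂) in
/-- `φ : M₁ × M₂ → M'` is `M₂`-totally geodesic: `h(Z, W) = 0` for `Z`, `W` tangent to `M₂`. -/
def Metric.IsSecondTotallyGeodesic (g' : Metric I' M') (φ : M₁ × M₂ → M') : Prop :=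
  ∀ (x : M₁ × M₂) (Z W : TangentSpace I₂ x.2),
    g'.secondForm (I₁.prod I₂) φ x (tangentPair 0 Z) (tangentPair 0 W) = 0

end DoublyWarped

end DWP

end

/-! Everything follows from one formula. Write f_i = ρ_i ∘ φ_i, and let h_i be the second
fundamental form of φ_i. Then h((X₁,X₂),(Y₁,Y₂)) = (h₁(X₁,Y₁), h₂(X₂,Y₂)) - f₂² g₁(X₁,Y₁) D ln ρ₂ -
f₁² g₂(X₂,Y₂) D ln ρ₁, which is `secondForm_prodMap`.

Its source is the Levi-Civita connection of the ambient product, `christoffel_doublyWarpedMetric`.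
Beyond the two factor connections, the warping adds terms such as (X₂ ln ρ₂) Y₁ and gradient terms
such as ρ₂² g₁'(X₁,Y₁) grad ln ρ₂. Evaluated on vectors dφ(X), dφ(Y), the terms of the first kind
are tangent to φ, so the normal projection removes them. It turns each gradient into the
corresponding D ln ρ_i, and it acts factor by factor (`normalPart_tangentPair`). No term of the
formula couples X₁ with Y₂, hence φ is mixed totally geodesic.

The second point is orthogonality: D ln ρ₂ lies in the second factor and h₁ in the first, and
symmetrically (`normalGrad_log_fst`, `normalGrad_log_snd`). By Pythagoras, h(X,Y) for X, Y in the
first factor vanishes exactly when h₁(X,Y) = 0 and g₁(X,Y) D ln ρ₂ = 0; taking X = Y ≠ 0 gives the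
criterion for N₁-total geodesy. In an orthonormal basis adapted to the factors, Pythagoras gives
`secondFormNormSq_prodMap`: ‖h‖² = f₂⁻² ‖h₁‖² + f₁⁻² ‖h₂‖² + n₁ ‖D ln ρ₂‖² + n₂ ‖D ln ρ₁‖², from
which the inequality and its equality case are read off. -/

noncomputable section

namespace DWP

/-! ### Metric duality and the normal projection. -/

section Riemannian

set_option linter.unusedSectionVars false

variable {E : Type*} [NormedAddCommGroup E] [NormedSpace ℝ E] [FiniteDimensional ℝ E]
  {H : Type*} [TopologicalSpace H] {I : ModelWithCorners ℝ E H}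
  {M : Type*} [TopologicalSpace M] [ChartedSpace H M] [IsManifold I ∞ M]
  {E' : Type*} [NormedAddCommGroup E'] [NormedSpace ℝ E'] [FiniteDimensional ℝ E']
  {H' : Type*} [TopologicalSpace H'] {I' : ModelWithCorners ℝ E' H'}
  {M' : Type*} [TopologicalSpace M'] [ChartedSpace H' M'] [IsManifold I' ∞ M']

/-- Gradients and Christoffel vectors are chosen Riesz representatives, so identities between them
are proved by pairing with an arbitrary vector. -/
theorem Metric.ext_inner (g : Metric I M) {p : M} {v w : TangentSpace I p}
    (h : ∀ z, g.inner p v z = g.inner p w z) : v = w := by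
  by_contra hne
  refine (g.pos p (v - w) (sub_ne_zero.2 hne)).ne' ?_
  rw [map_sub (g.inner p), sub_apply, h, sub_self]

theorem Metric.inner_sharp (g : Metric I M) (p : M) (α : TangentSpace I p →L[ℝ] ℝ)
    (w : TangentSpace I p) : g.inner p (g.sharp p α) w = α w :=
  (g.exists_sharp p α).choose_spec w

theorem Metric.inner_grad (g : Metric I M) (F : M → ℝ) (p : M) (w : TangentSpace I p) :
    g.inner p (g.grad F p) w = mfderiv I 𝓘(ℝ, ℝ) F p w :=
  g.inner_sharp p _ w

theorem Metric.normSq_nonneg (g : Metric I M) (p : M) (v : TangentSpace I p) :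
    0 ≤ g.normSq p v := by
  rcases eq_or_ne v 0 with rfl | h
  · simp [Metric.normSq]
  · exact (g.pos p v h).le

theorem Metric.normSq_eq_zero (g : Metric I M) {p : M} {v : TangentSpace I p} :
    g.normSq p v = 0 ↔ v = 0 := by
  refine ⟨fun h => ?_, fun h => by simp [Metric.normSq, h]⟩
  by_contra hv
  exact (g.pos p v hv).ne' h

section NormalPart

variable (g' : Metric I' M') (φ : M → M') (p : M)

theorem Metric.inner_normalPart (v : TangentSpace I' (φ p)) (X : TangentSpace I p) :
    g'.inner (φ p) (g'.normalPart I φ p v) (mfderiv I I' φ p X) = 0 :=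
  (g'.exists_normalPart I φ p v).choose_spec.1 X

theorem Metric.exists_sub_normalPart (v : TangentSpace I' (φ p)) :
    ∃ X : TangentSpace I p, v - g'.normalPart I φ p v = mfderiv I I' φ p X :=
  (g'.exists_normalPart I φ p v).choose_spec.2

-- The difference of two candidates is both tangent to φ and orthogonal to every tangent vector, so
-- positivity makes it zero. This uniqueness makes the chosen normal part computable; linearity
-- follows from it.
variable {φ p} in
theorem Metric.normalPart_eq {v n : TangentSpace I' (φ p)}
    (hn : ∀ X : TangentSpace I p, g'.inner (φ p) n (mfderiv I I' φ p X) = 0)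
    (hv : ∃ X : TangentSpace I p, v - n = mfderiv I I' φ p X) :
    g'.normalPart I φ p v = n := by
  obtain ⟨X, hX⟩ := hv
  obtain ⟨Y, hY⟩ := g'.exists_sub_normalPart (I := I) φ p v
  have e : g'.normalPart I φ p v - n = mfderiv I I' φ p (X - Y) := by
    rw [map_sub, ← hX, ← hY]; abel
  have h := g'.inner_normalPart (I := I) φ p v (X - Y)
  have h' := hn (X - Y)
  rw [← sub_eq_zero]
  by_contra hne
  have hpos := g'.pos (φ p) _ hne
  nth_rw 2 [e] at hpos
  rw [map_sub (g'.inner (φ p)), sub_apply, h, h', sub_self] at hpos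
  exact hpos.false

theorem Metric.normalPart_add (v w : TangentSpace I' (φ p)) :
    g'.normalPart I φ p (v + w) = g'.normalPart I φ p v + g'.normalPart I φ p w := by
  refine g'.normalPart_eq (I := I) (fun X => ?_) ?_
  · rw [map_add (g'.inner (φ p)), add_apply, g'.inner_normalPart (I := I), g'.inner_normalPart (I := I), add_zero]
  · obtain ⟨X, hX⟩ := g'.exists_sub_normalPart (I := I) φ p v
    obtain ⟨Y, hY⟩ := g'.exists_sub_normalPart (I := I) φ p w
    exact ⟨X + Y, by rw [map_add, ← hX, ← hY]; abel⟩

theorem Metric.normalPart_smul (c : ℝ) (v : TangentSpace I' (φ p)) :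
    g'.normalPart I φ p (c • v) = c • g'.normalPart I φ p v := by
  refine g'.normalPart_eq (I := I) (fun X => ?_) ?_
  · rw [map_smul (g'.inner (φ p)), smul_apply, g'.inner_normalPart (I := I), smul_zero]
  · obtain ⟨X, hX⟩ := g'.exists_sub_normalPart (I := I) φ p v
    exact ⟨c • X, by rw [map_smul, ← hX, smul_sub]⟩

theorem Metric.normalPart_mfderiv (X : TangentSpace I p) :
    g'.normalPart I φ p (mfderiv I I' φ p X) = 0 :=
  g'.normalPart_eq (I := I) (fun Y => by simp) ⟨X, by simp⟩

end NormalPart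

/-! ### Bilinearity of the Christoffel map and of the second fundamental form. -/

section SecondForm

/-- The Koszul combination `(D_X(Y, Z) + D_Y(X, Z) - D_Z(X, Y)) / 2`. -/
def koszul (D : E →L[ℝ] E →L[ℝ] E →L[ℝ] ℝ) (X Y Z : E) : ℝ :=
  (1 / 2 : ℝ) * (D X Y Z + D Y X Z - D Z X Y)

theorem Metric.inner_christoffel (g : Metric I M) (p : M) (X Y Z : TangentSpace I p) :
    g.inner p (g.christoffel p X Y) Z =
      koszul (fderiv ℝ (g.coeff p) (extChartAt I p p)) X Y Z :=
  g.inner_sharp p _ Z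

theorem koszul_add_left (D : E →L[ℝ] E →L[ℝ] E →L[ℝ] ℝ) (X X' Y Z : E) :
    koszul D (X + X') Y Z = koszul D X Y Z + koszul D X' Y Z := by
  simp only [koszul, map_add, _root_.add_apply]
  ring

theorem koszul_smul_left (D : E →L[ℝ] E →L[ℝ] E →L[ℝ] ℝ) (c : ℝ) (X Y Z : E) :
    koszul D (c • X) Y Z = c * koszul D X Y Z := by
  simp only [koszul, map_smul, _root_.smul_apply, smul_eq_mul]
  ring

theorem koszul_add_right (D : E →L[ℝ] E →L[ℝ] E →L[ℝ] ℝ) (X Y Y' Z : E) :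
    koszul D X (Y + Y') Z = koszul D X Y Z + koszul D X Y' Z := by
  simp only [koszul, map_add, _root_.add_apply]
  ring

theorem koszul_smul_right (D : E →L[ℝ] E →L[ℝ] E →L[ℝ] ℝ) (c : ℝ) (X Y Z : E) :
    koszul D X (c • Y) Z = c * koszul D X Y Z := by
  simp only [koszul, map_smul, _root_.smul_apply, smul_eq_mul]
  ring

theorem Metric.christoffel_add_left (g : Metric I M) (p : M) (X X' Y : TangentSpace I p) :
    g.christoffel p (X + X') Y = g.christoffel p X Y + g.christoffel p X' Y := by
  refine g.ext_inner fun Z => ?_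
  rw [map_add (g.inner p), add_apply]
  simp only [g.inner_christoffel]
  exact koszul_add_left ..

theorem Metric.christoffel_smul_left (g : Metric I M) (p : M) (c : ℝ) (X Y : TangentSpace I p) :
    g.christoffel p (c • X) Y = c • g.christoffel p X Y := by
  refine g.ext_inner fun Z => ?_
  rw [map_smul (g.inner p), smul_apply, smul_eq_mul]
  simp only [g.inner_christoffel]
  exact koszul_smul_left ..

theorem Metric.christoffel_add_right (g : Metric I M) (p : M) (X Y Y' : TangentSpace I p) :
    g.christoffel p X (Y + Y') = g.christoffel p X Y + g.christoffel p X Y' := by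
  refine g.ext_inner fun Z => ?_
  rw [map_add (g.inner p), add_apply]
  simp only [g.inner_christoffel]
  exact koszul_add_right ..

theorem Metric.christoffel_smul_right (g : Metric I M) (p : M) (c : ℝ) (X Y : TangentSpace I p) :
    g.christoffel p X (c • Y) = c • g.christoffel p X Y := by
  refine g.ext_inner fun Z => ?_
  rw [map_smul (g.inner p), smul_apply, smul_eq_mul]
  simp only [g.inner_christoffel]
  exact koszul_smul_right ..

variable (I) in
/-- The second derivative of `φ` in the preferred charts around `p` and `φ p`. -/
def chartHessian (φ : M → M') (p : M) :
    TangentSpace I p →ₗ[ℝ] TangentSpace I p →ₗ[ℝ] TangentSpace I' (φ p) :=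
  LinearMap.mk₂ ℝ (fun X Y => (fderiv ℝ (fderiv ℝ (writtenInExtChartAt I I' p φ))
      (extChartAt I p p) : E →L[ℝ] E →L[ℝ] E') X Y)
    (fun X X' Y => by exact congrArg (fun L : E →L[ℝ] E' => L Y) (map_add _ (X : E) (X' : E)))
    (fun c X Y => by exact congrArg (fun L : E →L[ℝ] E' => L Y) (map_smul _ c (X : E)))
    (fun X Y Y' => by exact map_add _ (Y : E) (Y' : E))
    (fun c X Y => by exact map_smul _ c (Y : E))

variable (I) in
/-- The ambient Levi-Civita derivative `∇_X dφ(Y)`, before the projection to the normal space. -/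
def Metric.ambientDeriv (g' : Metric I' M') (φ : M → M') (p : M) (X Y : TangentSpace I p) :
    TangentSpace I' (φ p) :=
  chartHessian I φ p X Y + g'.christoffel (φ p) (mfderiv I I' φ p X) (mfderiv I I' φ p Y)

/-- Separates the normal projection from the derivative it is applied to, so that each can be
handled by its own linearity. -/
theorem Metric.secondForm_eq (g' : Metric I' M') (φ : M → M') (p : M) (X Y : TangentSpace I p) :
    g'.secondForm I φ p X Y = g'.normalPart I φ p (g'.ambientDeriv I φ p X Y) :=
  rfl

variable (I) in
/-- The second fundamental form as a bilinear map. -/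
def Metric.secondFormBilin (g' : Metric I' M') (φ : M → M') (p : M) :
    TangentSpace I p →ₗ[ℝ] TangentSpace I p →ₗ[ℝ] TangentSpace I' (φ p) :=
  LinearMap.mk₂ ℝ (fun X Y => g'.secondForm I φ p X Y)
    (fun X X' Y => by
      simp only [g'.secondForm_eq, ← g'.normalPart_add, ambientDeriv]
      rw [map_add, map_add, LinearMap.add_apply, g'.christoffel_add_left]; congr 1; abel)
    (fun c X Y => by
      simp only [g'.secondForm_eq, ← g'.normalPart_smul, ambientDeriv]
      rw [map_smul, map_smul, LinearMap.smul_apply, g'.christoffel_smul_left, smul_add])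
    (fun X Y Y' => by
      simp only [g'.secondForm_eq, ← g'.normalPart_add, ambientDeriv]
      rw [map_add, map_add, g'.christoffel_add_right]; congr 1; abel)
    (fun c X Y => by
      simp only [g'.secondForm_eq, ← g'.normalPart_smul, ambientDeriv]
      rw [map_smul, map_smul, g'.christoffel_smul_right, smul_add])

theorem Metric.secondFormBilin_apply (g' : Metric I' M') (φ : M → M') (p : M)
    (X Y : TangentSpace I p) : g'.secondFormBilin I φ p X Y = g'.secondForm I φ p X Y :=
  rfl

theorem Metric.secondForm_zero_left (g' : Metric I' M') (φ : M → M') (p : M)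
    (Y : TangentSpace I p) : g'.secondForm I φ p 0 Y = 0 := by
  rw [← g'.secondFormBilin_apply, map_zero, LinearMap.zero_apply]

theorem Metric.secondForm_zero_right (g' : Metric I' M') (φ : M → M') (p : M)
    (X : TangentSpace I p) : g'.secondForm I φ p X 0 = 0 := by
  rw [← g'.secondFormBilin_apply, map_zero]

theorem Metric.secondForm_smul_smul (g' : Metric I' M') (φ : M → M') (p : M) (c : ℝ)
    (X Y : TangentSpace I p) :
    g'.secondForm I φ p (c • X) (c • Y) = c ^ 2 • g'.secondForm I φ p X Y := by
  simp only [← g'.secondFormBilin_apply, map_smul, LinearMap.smul_apply, smul_smul, sq]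

end SecondForm

/-! ### Metric coefficients and maps in the preferred charts. -/

section Chart

/-- In a boundaryless manifold, the metric coefficients in a chart, in terms of the
trivialization of the tangent bundle. -/
theorem Metric.coeff_apply [I.Boundaryless] (g : Metric I M) (p : M) {y : E}
    (hy : y ∈ (extChartAt I p).target) (v w : E) :
    g.coeff p y v w = g.inner ((extChartAt I p).symm y)
      ((trivializationAt E (TangentSpace I) p).symmL ℝ ((extChartAt I p).symm y) v)
      ((trivializationAt E (TangentSpace I) p).symmL ℝ ((extChartAt I p).symm y) w) := by
  have : IsManifold I 1 M := IsManifold.of_le (n := ∞) (by simp)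
  have hx : (extChartAt I p).symm y ∈ (chartAt H p).source := by
    simpa using (extChartAt I p).map_target hy
  rw [TangentBundle.symmL_trivializationAt hx, (extChartAt I p).right_inv hy,
    I.range_eq_univ, mfderivWithin_univ]
  rfl

/-- At the centre of the preferred chart, the trivialization is the identity under the
identification of the tangent space with the model space. -/
theorem Metric.coeff_self [I.Boundaryless] (g : Metric I M) (p : M) (v w : E) :
    g.coeff p (extChartAt I p p) v w = g.inner p v w := by
  have : IsManifold I 1 M := IsManifold.of_le (n := ∞) (by simp)
  rw [g.coeff_apply p (mem_extChartAt_target p), extChartAt_to_inv]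
  have h (v : E) : (trivializationAt E (TangentSpace I) p).symmL ℝ p v = v := by
    rw [TangentBundle.symmL_trivializationAt_eq_core (mem_chart_source H p)]
    exact tangentCoordChange_self (I := I) (mem_extChartAt_source p)
  rw [h v, h w]

/-- Near the centre, the coefficients are the smooth section g read in a trivialization and composed
with the inverse chart. Differentiability ensures that the `fderiv` in `christoffel` is a genuine
derivative. -/
theorem Metric.differentiableAt_coeff [I.Boundaryless] (g : Metric I M) (p : M) :
    DifferentiableAt ℝ (g.coeff p) (extChartAt I p p) := by
  have c := (Bundle.contMDiffAt_section p).1 (g.contMDiff p)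
  have s : ContMDiffAt 𝓘(ℝ, E) I ∞ (extChartAt I p).symm (extChartAt I p p) :=
    (contMDiffOn_extChartAt_symm p).contMDiffAt (extChartAt_target_mem_nhds p)
  have c' := ContMDiffAt.comp_of_eq c s (extChartAt_to_inv p)
  refine (c'.contDiffAt.differentiableAt (by simp)).congr_of_eventuallyEq ?_
  filter_upwards [extChartAt_target_mem_nhds (I := I) p] with y hy
  refine ContinuousLinearMap.ext fun v => ContinuousLinearMap.ext fun w => ?_
  rw [g.coeff_apply p hy]
  exact (trivializationAt_inner_apply _
    (by simpa using (extChartAt I p).map_target hy) v w).symm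

theorem contDiffAt_writtenInExtChartAt [I.Boundaryless] {φ : M → M'} (hφ : ContMDiff I I' ∞ φ)
    (p : M) : ContDiffAt ℝ ∞ (writtenInExtChartAt I I' p φ) (extChartAt I p p) := by
  have h := (contMDiffAt_iff.1 (hφ p)).2
  rw [I.range_eq_univ, contDiffWithinAt_univ] at h
  exact h

end Chart

end Riemannian

/-! ### The Levi-Civita connection of a doubly warped product. -/

section DoublyWarped

set_option linter.unusedSectionVars false

variable {E₁ : Type*} [NormedAddCommGroup E₁] [NormedSpace ℝ E₁] [FiniteDimensional ℝ E₁]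
  {H₁ : Type*} [TopologicalSpace H₁] {I₁ : ModelWithCorners ℝ E₁ H₁}
  {M₁ : Type*} [TopologicalSpace M₁] [ChartedSpace H₁ M₁] [IsManifold I₁ ∞ M₁]
  {E₂ : Type*} [NormedAddCommGroup E₂] [NormedSpace ℝ E₂] [FiniteDimensional ℝ E₂]
  {H₂ : Type*} [TopologicalSpace H₂] {I₂ : ModelWithCorners ℝ E₂ H₂}
  {M₂ : Type*} [TopologicalSpace M₂] [ChartedSpace H₂ M₂] [IsManifold I₂ ∞ M₂]

theorem tangentPair_add {x : M₁ × M₂} (a a' : TangentSpace I₁ x.1) (b b' : TangentSpace I₂ x.2) :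
    (tangentPair (a + a') (b + b') : TangentSpace (I₁.prod I₂) x) =
      tangentPair a b + tangentPair a' b' :=
  rfl

theorem tangentPair_sub {x : M₁ × M₂} (a a' : TangentSpace I₁ x.1) (b b' : TangentSpace I₂ x.2) :
    (tangentPair (a - a') (b - b') : TangentSpace (I₁.prod I₂) x) =
      tangentPair a b - tangentPair a' b' :=
  rfl

theorem smul_tangentPair {x : M₁ × M₂} (c : ℝ) (a : TangentSpace I₁ x.1)
    (b : TangentSpace I₂ x.2) :
    c • (tangentPair a b : TangentSpace (I₁.prod I₂) x) = tangentPair (c • a) (c • b) :=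
  rfl

section Christoffel

variable (g₁ : Metric I₁ M₁) (g₂ : Metric I₂ M₂) (f₁ : WarpingFunction I₁ M₁)
  (f₂ : WarpingFunction I₂ M₂)

theorem doublyWarpedMetric_inner (x : M₁ × M₂) (a c : TangentSpace I₁ x.1)
    (b d : TangentSpace I₂ x.2) :
    (doublyWarpedMetric g₁ g₂ f₁ f₂).inner x (tangentPair a b) (tangentPair c d) =
      f₂.toFun x.2 ^ 2 * g₁.inner x.1 a c + f₁.toFun x.1 ^ 2 * g₂.inner x.2 b d :=
  warpedInner_apply ..

theorem doublyWarpedMetric_normSq (x : M₁ × M₂) (a : TangentSpace I₁ x.1)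
    (b : TangentSpace I₂ x.2) :
    (doublyWarpedMetric g₁ g₂ f₁ f₂).normSq x (tangentPair a b) =
      f₂.toFun x.2 ^ 2 * g₁.normSq x.1 a + f₁.toFun x.1 ^ 2 * g₂.normSq x.2 b :=
  warpedInner_apply ..

/-- The preferred chart of a product is the product of the preferred charts, and its trivialization
splits by `symmL_prod`; in coordinates the metric is therefore again a warped sum. -/
theorem coeff_doublyWarpedMetric [I₁.Boundaryless] [I₂.Boundaryless] (x : M₁ × M₂) {y : E₁ × E₂}
    (hy₁ : y.1 ∈ (extChartAt I₁ x.1).target) (hy₂ : y.2 ∈ (extChartAt I₂ x.2).target)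
    (v w : E₁ × E₂) :
    (doublyWarpedMetric g₁ g₂ f₁ f₂).coeff x y v w =
      f₂.toFun ((extChartAt I₂ x.2).symm y.2) ^ 2 * g₁.coeff x.1 y.1 v.1 w.1 +
        f₁.toFun ((extChartAt I₁ x.1).symm y.1) ^ 2 * g₂.coeff x.2 y.2 v.2 w.2 := by
  have hy : y ∈ (extChartAt (I₁.prod I₂) x).target := by
    rw [extChartAt_prod]; exact ⟨hy₁, hy₂⟩
  have e : (extChartAt (I₁.prod I₂) x).symm y =
      ((extChartAt I₁ x.1).symm y.1, (extChartAt I₂ x.2).symm y.2) := by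
    rw [extChartAt_prod]; rfl
  rw [g₁.coeff_apply x.1 hy₁, g₂.coeff_apply x.2 hy₂, Metric.coeff_apply _ x hy, e,
    symmL_prod (by simpa using (extChartAt I₁ x.1).map_target hy₁)
      (by simpa using (extChartAt I₂ x.2).map_target hy₂),
    symmL_prod (by simpa using (extChartAt I₁ x.1).map_target hy₁)
      (by simpa using (extChartAt I₂ x.2).map_target hy₂)]
  exact warpedInner_apply ..

theorem WarpingFunction.mdifferentiableAt (f : WarpingFunction I₁ M₁) (p : M₁) :
    MDifferentiableAt I₁ 𝓘(ℝ, ℝ) f.toFun p :=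
  (f.contMDiff p).mdifferentiableAt (by simp)

/-- The differential of a positive function, as a linear map on the model space. -/
def WarpingFunction.deriv (f : WarpingFunction I₁ M₁) (p : M₁) : E₁ →L[ℝ] ℝ :=
  mfderiv I₁ 𝓘(ℝ, ℝ) f.toFun p

theorem WarpingFunction.hasFDerivAt [I₁.Boundaryless] (f : WarpingFunction I₁ M₁) (p : M₁) :
    HasFDerivAt (f.toFun ∘ (extChartAt I₁ p).symm) (f.deriv p) (extChartAt I₁ p p) := by
  have h : HasFDerivWithinAt (f.toFun ∘ (extChartAt I₁ p).symm) (f.deriv p) (Set.range I₁)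
      (extChartAt I₁ p p) := (f.mdifferentiableAt p).hasMFDerivAt.2
  rwa [I₁.range_eq_univ, hasFDerivWithinAt_univ] at h

theorem hasFDerivAt_sq_mul {E : Type*} [NormedAddCommGroup E] [NormedSpace ℝ E] {a G : E → ℝ}
    {a' G' : E →L[ℝ] ℝ} {u : E} (ha : HasFDerivAt a a' u) (hG : HasFDerivAt G G' u) :
    HasFDerivAt (fun y => a y ^ 2 * G y) ((a u ^ 2) • G' + (2 * a u * G u) • a') u := by
  refine ((ha.pow 2).mul hG).congr_fderiv ?_
  ext v
  simp
  ring

theorem hasFDerivAt_apply_apply {V : Type*} [NormedAddCommGroup V] [NormedSpace ℝ V]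
    {G : V → V →L[ℝ] V →L[ℝ] ℝ} {u : V} (hG : DifferentiableAt ℝ G u) (Y Z : V) :
    HasFDerivAt (fun y => G y Y Z) (((fderiv ℝ G u).flip Y).flip Z) u := by
  have h := (hG.hasFDerivAt.clm_apply (hasFDerivAt_const Y u)).clm_apply (hasFDerivAt_const Z u)
  refine h.congr_fderiv ?_
  ext v
  simp

/-- The product rule for ρ₂² G₁ + ρ₁² G₂, where each G_i and each ρ_i depends on the variable of its
own factor only. -/
theorem fderiv_coeff_doublyWarpedMetric [I₁.Boundaryless] [I₂.Boundaryless] (x : M₁ × M₂)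
    (X Y Z : E₁ × E₂) :
    fderiv ℝ ((doublyWarpedMetric g₁ g₂ f₁ f₂).coeff x) (extChartAt (I₁.prod I₂) x x) X Y Z =
      f₂.toFun x.2 ^ 2 * fderiv ℝ (g₁.coeff x.1) (extChartAt I₁ x.1 x.1) X.1 Y.1 Z.1 +
        2 * f₂.toFun x.2 * g₁.inner x.1 Y.1 Z.1 * f₂.deriv x.2 X.2 +
      (f₁.toFun x.1 ^ 2 * fderiv ℝ (g₂.coeff x.2) (extChartAt I₂ x.2 x.2) X.2 Y.2 Z.2 +
        2 * f₁.toFun x.1 * g₂.inner x.2 Y.2 Z.2 * f₁.deriv x.1 X.1) := by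
  set g := doublyWarpedMetric g₁ g₂ f₁ f₂
  have hu : extChartAt (I₁.prod I₂) x x = (extChartAt I₁ x.1 x.1, extChartAt I₂ x.2 x.2) := by
    rw [extChartAt_prod]; rfl
  have h := hasFDerivAt_apply_apply (g.differentiableAt_coeff x) Y Z
  rw [hu] at h ⊢
  set u₁ := extChartAt I₁ x.1 x.1
  set u₂ := extChartAt I₂ x.2 x.2
  have p₁ : HasFDerivAt (Prod.fst : E₁ × E₂ → E₁) (ContinuousLinearMap.fst ℝ E₁ E₂) (u₁, u₂) :=
    hasFDerivAt_fst
  have p₂ : HasFDerivAt (Prod.snd : E₁ × E₂ → E₂) (ContinuousLinearMap.snd ℝ E₁ E₂) (u₁, u₂) :=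
    hasFDerivAt_snd
  have G₁ := HasFDerivAt.comp (u₁, u₂) (hasFDerivAt_apply_apply (g₁.differentiableAt_coeff x.1) Y.1 Z.1) p₁
  have G₂ := HasFDerivAt.comp (u₁, u₂) (hasFDerivAt_apply_apply (g₂.differentiableAt_coeff x.2) Y.2 Z.2) p₂
  have a₁ := HasFDerivAt.comp (u₁, u₂) (f₁.hasFDerivAt x.1) p₁
  have a₂ := HasFDerivAt.comp (u₁, u₂) (f₂.hasFDerivAt x.2) p₂
  have k := (hasFDerivAt_sq_mul a₂ G₁).add (hasFDerivAt_sq_mul a₁ G₂)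
  have n₁ : ∀ᶠ y : E₁ × E₂ in 𝓝 (u₁, u₂), y.1 ∈ (extChartAt I₁ x.1).target :=
    continuous_fst.continuousAt.eventually (extChartAt_target_mem_nhds (I := I₁) x.1)
  have n₂ : ∀ᶠ y : E₁ × E₂ in 𝓝 (u₁, u₂), y.2 ∈ (extChartAt I₂ x.2).target :=
    continuous_snd.continuousAt.eventually (extChartAt_target_mem_nhds (I := I₂) x.2)
  -- The warped-sum formula holds on the chart targets only, which suffices because they are
  -- neighbourhoods of the centre.
  have k' := k.congr_of_eventuallyEq (f₁ := fun y => g.coeff x y Y Z) (by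
    filter_upwards [n₁, n₂] with y h₁ h₂
    exact coeff_doublyWarpedMetric g₁ g₂ f₁ f₂ x h₁ h₂ Y Z)
  have e := congrArg (fun L : E₁ × E₂ →L[ℝ] ℝ => L X) (h.unique k')
  refine e.trans ?_
  have c₁ := g₁.coeff_self x.1 Y.1 Z.1
  have c₂ := g₂.coeff_self x.2 Y.2 Z.2
  rw [← c₁, ← c₂]
  simp [u₁, u₂]

/-- The factor 2 in d(ρ²) = 2ρ dρ cancels the Koszul 1/2. The dρ(X) and dρ(Y) terms become multiples
of Y and X in the Christoffel vector; the dρ(Z) term, with its minus sign, becomes a gradient. -/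
theorem koszul_doublyWarpedMetric [I₁.Boundaryless] [I₂.Boundaryless] (x : M₁ × M₂)
    (X Y Z : E₁ × E₂) :
    koszul (fderiv ℝ ((doublyWarpedMetric g₁ g₂ f₁ f₂).coeff x) (extChartAt (I₁.prod I₂) x x))
        X Y Z =
      f₂.toFun x.2 ^ 2 * koszul (fderiv ℝ (g₁.coeff x.1) (extChartAt I₁ x.1 x.1)) X.1 Y.1 Z.1 +
      f₁.toFun x.1 ^ 2 * koszul (fderiv ℝ (g₂.coeff x.2) (extChartAt I₂ x.2 x.2)) X.2 Y.2 Z.2 +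
      f₂.toFun x.2 * (f₂.deriv x.2 X.2 * g₁.inner x.1 Y.1 Z.1 +
        f₂.deriv x.2 Y.2 * g₁.inner x.1 X.1 Z.1 - f₂.deriv x.2 Z.2 * g₁.inner x.1 X.1 Y.1) +
      f₁.toFun x.1 * (f₁.deriv x.1 X.1 * g₂.inner x.2 Y.2 Z.2 +
        f₁.deriv x.1 Y.1 * g₂.inner x.2 X.2 Z.2 - f₁.deriv x.1 Z.1 * g₂.inner x.2 X.2 Y.2) := by
  simp only [koszul, fderiv_coeff_doublyWarpedMetric]
  ring

theorem mfderiv_log_comp (f : WarpingFunction I₁ M₁) (p : M₁) (Z : TangentSpace I₁ p) :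
    MDifferentiableAt I₁ 𝓘(ℝ, ℝ) (fun y => Real.log (f.toFun y)) p ∧
    mfderiv I₁ 𝓘(ℝ, ℝ) (fun y => Real.log (f.toFun y)) p Z = (f.toFun p)⁻¹ * f.deriv p Z := by
  have h₂ := (f.mdifferentiableAt p).hasMFDerivAt
  have h₃ := (Real.hasDerivAt_log (f.pos p).ne').hasFDerivAt.hasMFDerivAt
  have h := h₃.comp p h₂
  refine ⟨h.mdifferentiableAt, ?_⟩
  refine (congrArg (fun L : E₁ →L[ℝ] ℝ => L Z) h.mfderiv).trans ?_
  exact mul_comm (f.deriv p Z) _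

/-- The warped metric restricts to ρ₂² g₁ on the first factor, so raising an index costs ρ₂⁻². A
function of the first variable has no derivative along the second factor, which puts its gradient in
the first. -/
theorem grad_comp_fst {F : M₁ → ℝ} {x : M₁ × M₂} (hF : MDifferentiableAt I₁ 𝓘(ℝ, ℝ) F x.1) :
    (doublyWarpedMetric g₁ g₂ f₁ f₂).grad (fun y => F y.1) x =
      tangentPair ((f₂.toFun x.2 ^ 2)⁻¹ • g₁.grad F x.1) 0 := by
  refine (doublyWarpedMetric g₁ g₂ f₁ f₂).ext_inner fun Z => ?_
  obtain ⟨Z₁, Z₂, rfl⟩ := exists_tangentPair Z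
  have h := (hF.hasMFDerivAt.comp x (hasMFDerivAt_fst (I := I₁) (I' := I₂) x)).mfderiv
  have hpos := (f₂.pos x.2).ne'
  rw [doublyWarpedMetric_inner, map_smul (g₁.inner x.1), map_zero, smul_apply,
    zero_apply, mul_zero, add_zero, smul_eq_mul, mul_inv_cancel_left₀ (by positivity),
    Metric.inner_grad, g₁.inner_grad]
  exact congrArg (fun L : E₁ × E₂ →L[ℝ] ℝ => L (Z₁, Z₂)) h

theorem grad_comp_snd {F : M₂ → ℝ} {x : M₁ × M₂} (hF : MDifferentiableAt I₂ 𝓘(ℝ, ℝ) F x.2) :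
    (doublyWarpedMetric g₁ g₂ f₁ f₂).grad (fun y => F y.2) x =
      tangentPair 0 ((f₁.toFun x.1 ^ 2)⁻¹ • g₂.grad F x.2) := by
  refine (doublyWarpedMetric g₁ g₂ f₁ f₂).ext_inner fun Z => ?_
  obtain ⟨Z₁, Z₂, rfl⟩ := exists_tangentPair Z
  have h := (hF.hasMFDerivAt.comp x (hasMFDerivAt_snd (I := I₁) (I' := I₂) x)).mfderiv
  have hpos := (f₁.pos x.1).ne'
  rw [doublyWarpedMetric_inner, map_smul (g₂.inner x.2), map_zero, smul_apply,
    zero_apply, mul_zero, zero_add, smul_eq_mul, mul_inv_cancel_left₀ (by positivity),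
    Metric.inner_grad, g₂.inner_grad]
  exact congrArg (fun L : E₁ × E₂ →L[ℝ] ℝ => L (Z₁, Z₂)) h

/-- The Christoffel map of a doubly warped product. -/
theorem christoffel_doublyWarpedMetric [I₁.Boundaryless] [I₂.Boundaryless] (x : M₁ × M₂)
    (X₁ Y₁ : TangentSpace I₁ x.1) (X₂ Y₂ : TangentSpace I₂ x.2) :
    (doublyWarpedMetric g₁ g₂ f₁ f₂).christoffel x (tangentPair X₁ X₂) (tangentPair Y₁ Y₂) =
      tangentPair (g₁.christoffel x.1 X₁ Y₁) (g₂.christoffel x.2 X₂ Y₂) +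
      tangentPair (((f₂.toFun x.2)⁻¹ * f₂.deriv x.2 X₂) • Y₁ +
          ((f₂.toFun x.2)⁻¹ * f₂.deriv x.2 Y₂) • X₁)
        (((f₁.toFun x.1)⁻¹ * f₁.deriv x.1 X₁) • Y₂ + ((f₁.toFun x.1)⁻¹ * f₁.deriv x.1 Y₁) • X₂) -
      ((f₂.toFun x.2 ^ 2 * g₁.inner x.1 X₁ Y₁) •
          (doublyWarpedMetric g₁ g₂ f₁ f₂).grad (fun y => Real.log (f₂.toFun y.2)) x +
        (f₁.toFun x.1 ^ 2 * g₂.inner x.2 X₂ Y₂) •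
          (doublyWarpedMetric g₁ g₂ f₁ f₂).grad (fun y => Real.log (f₁.toFun y.1)) x) := by
  refine (doublyWarpedMetric g₁ g₂ f₁ f₂).ext_inner fun Z => ?_
  obtain ⟨Z₁, Z₂, rfl⟩ := exists_tangentPair Z
  rw [Metric.inner_christoffel]
  refine (koszul_doublyWarpedMetric g₁ g₂ f₁ f₂ x (X₁, X₂) (Y₁, Y₂) (Z₁, Z₂)).trans ?_
  -- Only the differentiability half is needed here; the vector `0` is a dummy argument.
  rw [grad_comp_fst _ _ _ _ (mfderiv_log_comp f₁ x.1 0).1,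
    grad_comp_snd _ _ _ _ (mfderiv_log_comp f₂ x.2 0).1]
  rw [smul_tangentPair, smul_tangentPair, ← tangentPair_add, ← tangentPair_add, ← tangentPair_sub,
    doublyWarpedMetric_inner]
  simp only [map_add, map_sub, map_smul, map_zero, add_apply, sub_apply, smul_apply, zero_apply,
    smul_eq_mul, smul_zero]
  rw [g₁.inner_christoffel, g₂.inner_christoffel, g₁.inner_grad, g₂.inner_grad,
    (mfderiv_log_comp f₁ x.1 Z₁).2, (mfderiv_log_comp f₂ x.2 Z₂).2]
  have h₁ := (f₁.pos x.1).ne'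
  have h₂ := (f₂.pos x.2).ne'
  field_simp
  ring

end Christoffel

end DoublyWarped

/-! ### The second fundamental form of a product immersion. -/

section ProductImmersion

set_option linter.unusedSectionVars false

variable {E₁ : Type*} [NormedAddCommGroup E₁] [NormedSpace ℝ E₁] [FiniteDimensional ℝ E₁]
  {H₁ : Type*} [TopologicalSpace H₁] {I₁ : ModelWithCorners ℝ E₁ H₁} [I₁.Boundaryless]
  {N₁ : Type*} [TopologicalSpace N₁] [ChartedSpace H₁ N₁] [IsManifold I₁ ∞ N₁]
  {E₂ : Type*} [NormedAddCommGroup E₂] [NormedSpace ℝ E₂] [FiniteDimensional ℝ E₂]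
  {H₂ : Type*} [TopologicalSpace H₂] {I₂ : ModelWithCorners ℝ E₂ H₂} [I₂.Boundaryless]
  {N₂ : Type*} [TopologicalSpace N₂] [ChartedSpace H₂ N₂] [IsManifold I₂ ∞ N₂]
  {F₁ : Type*} [NormedAddCommGroup F₁] [NormedSpace ℝ F₁] [FiniteDimensional ℝ F₁]
  {K₁ : Type*} [TopologicalSpace K₁] {J₁ : ModelWithCorners ℝ F₁ K₁} [J₁.Boundaryless]
  {M₁ : Type*} [TopologicalSpace M₁] [ChartedSpace K₁ M₁] [IsManifold J₁ ∞ M₁]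
  {F₂ : Type*} [NormedAddCommGroup F₂] [NormedSpace ℝ F₂] [FiniteDimensional ℝ F₂]
  {K₂ : Type*} [TopologicalSpace K₂] {J₂ : ModelWithCorners ℝ F₂ K₂} [J₂.Boundaryless]
  {M₂ : Type*} [TopologicalSpace M₂] [ChartedSpace K₂ M₂] [IsManifold J₂ ∞ M₂]

theorem hasFDerivAt_fderiv_of_contDiffAt {V W : Type*} [NormedAddCommGroup V] [NormedSpace ℝ V]
    [NormedAddCommGroup W] [NormedSpace ℝ W] {Φ : V → W} {v : V} (h : ContDiffAt ℝ ∞ Φ v) :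
    HasFDerivAt (fderiv ℝ Φ) (fderiv ℝ (fderiv ℝ Φ) v) v :=
  ((h.fderiv_right (m := 1) (WithTop.coe_le_coe.2 le_top)).differentiableAt
    (by simp)).hasFDerivAt

theorem fderiv_fderiv_prodMap {Φ₁ : E₁ → F₁} {Φ₂ : E₂ → F₂} {u : E₁ × E₂}
    (h₁ : ContDiffAt ℝ ∞ Φ₁ u.1) (h₂ : ContDiffAt ℝ ∞ Φ₂ u.2) (X Y : E₁ × E₂) :
    fderiv ℝ (fderiv ℝ (Prod.map Φ₁ Φ₂)) u X Y =
      (fderiv ℝ (fderiv ℝ Φ₁) u.1 X.1 Y.1, fderiv ℝ (fderiv ℝ Φ₂) u.2 X.2 Y.2) := by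
  have s := (hasFDerivAt_fderiv_of_contDiffAt (h₁.prodMap' h₂)).clm_apply (hasFDerivAt_const Y u)
  have s₁ := (HasFDerivAt.comp u (hasFDerivAt_fderiv_of_contDiffAt h₁) (hasFDerivAt_fst (p := u))).clm_apply
    (hasFDerivAt_const Y.1 u)
  have s₂ := (HasFDerivAt.comp u (hasFDerivAt_fderiv_of_contDiffAt h₂) (hasFDerivAt_snd (p := u))).clm_apply
    (hasFDerivAt_const Y.2 u)
  -- The outer derivative sees the first derivative on a neighbourhood, so the splitting of the
  -- latter is needed at all nearby points.
  have n₁ : ∀ᶠ y : E₁ × E₂ in 𝓝 u, ContDiffAt ℝ 1 Φ₁ y.1 :=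
    continuous_fst.continuousAt.eventually
      ((h₁.of_le (m := 1) (by exact_mod_cast le_top)).eventually (by simp))
  have n₂ : ∀ᶠ y : E₁ × E₂ in 𝓝 u, ContDiffAt ℝ 1 Φ₂ y.2 :=
    continuous_snd.continuousAt.eventually
      ((h₂.of_le (m := 1) (by exact_mod_cast le_top)).eventually (by simp))
  have k := (s₁.prodMk s₂).congr_of_eventuallyEq (f₁ := fun y => fderiv ℝ (Prod.map Φ₁ Φ₂) y Y) (by
    filter_upwards [n₁, n₂] with y d₁ d₂
    rw [((d₁.differentiableAt (by simp)).hasFDerivAt.prodMap y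
      (d₂.differentiableAt (by simp)).hasFDerivAt).fderiv]
    rfl)
  have e := congrArg (fun L : E₁ × E₂ →L[ℝ] F₁ × F₂ => L X) (s.unique k)
  simpa using e

variable {φ₁ : N₁ → M₁} {φ₂ : N₂ → M₂}

theorem chartHessian_prodMap (h₁ : ContMDiff I₁ J₁ ∞ φ₁) (h₂ : ContMDiff I₂ J₂ ∞ φ₂) (x : N₁ × N₂)
    (X₁ Y₁ : TangentSpace I₁ x.1) (X₂ Y₂ : TangentSpace I₂ x.2) :
    chartHessian (I' := J₁.prod J₂) (I₁.prod I₂) (Prod.map φ₁ φ₂) x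
        (tangentPair X₁ X₂) (tangentPair Y₁ Y₂) =
      tangentPair (x := Prod.map φ₁ φ₂ x) (chartHessian I₁ φ₁ x.1 X₁ Y₁)
        (chartHessian I₂ φ₂ x.2 X₂ Y₂) := by
  have e : writtenInExtChartAt (I₁.prod I₂) (J₁.prod J₂) x (Prod.map φ₁ φ₂) = _ :=
    writtenInExtChartAt_prod (x := x.1) (x' := x.2)
  have hu : extChartAt (I₁.prod I₂) x x = (extChartAt I₁ x.1 x.1, extChartAt I₂ x.2 x.2) := by
    rw [extChartAt_prod]; rfl
  have key := fderiv_fderiv_prodMap (u := (extChartAt I₁ x.1 x.1, extChartAt I₂ x.2 x.2))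
    (contDiffAt_writtenInExtChartAt h₁ x.1) (contDiffAt_writtenInExtChartAt h₂ x.2)
    (X₁, X₂) (Y₁, Y₂)
  rw [← e, ← hu] at key
  exact key

theorem mfderiv_prodMap_tangentPair (h₁ : ContMDiff I₁ J₁ ∞ φ₁) (h₂ : ContMDiff I₂ J₂ ∞ φ₂)
    (x : N₁ × N₂) (X₁ : TangentSpace I₁ x.1) (X₂ : TangentSpace I₂ x.2) :
    mfderiv (I₁.prod I₂) (J₁.prod J₂) (Prod.map φ₁ φ₂) x (tangentPair X₁ X₂) =
      tangentPair (x := Prod.map φ₁ φ₂ x) (mfderiv I₁ J₁ φ₁ x.1 X₁) (mfderiv I₂ J₂ φ₂ x.2 X₂) := by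
  have h := mfderiv_prodMap (p := x) ((h₁ x.1).mdifferentiableAt (by simp))
    ((h₂ x.2).mdifferentiableAt (by simp))
  exact congrArg (fun L : E₁ × E₂ →L[ℝ] F₁ × F₂ => L (X₁, X₂)) h

section

variable (g₁' : Metric J₁ M₁) (g₂' : Metric J₂ M₂) (ρ₁ : WarpingFunction J₁ M₁)
  (ρ₂ : WarpingFunction J₂ M₂)

/-- The image of dφ is the product of the images of the dφ_i, and the factors are orthogonal with
metrics merely rescaled. Normality and tangency can thus be tested in each component. -/
theorem normalPart_tangentPair (h₁ : ContMDiff I₁ J₁ ∞ φ₁) (h₂ : ContMDiff I₂ J₂ ∞ φ₂)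
    (x : N₁ × N₂) (v₁ : TangentSpace J₁ (φ₁ x.1)) (v₂ : TangentSpace J₂ (φ₂ x.2)) :
    (doublyWarpedMetric g₁' g₂' ρ₁ ρ₂).normalPart (I₁.prod I₂) (Prod.map φ₁ φ₂) x
        (tangentPair (x := Prod.map φ₁ φ₂ x) v₁ v₂) =
      tangentPair (x := Prod.map φ₁ φ₂ x) (g₁'.normalPart I₁ φ₁ x.1 v₁)
        (g₂'.normalPart I₂ φ₂ x.2 v₂) := by
  refine Metric.normalPart_eq _ (fun X => ?_) ?_
  · obtain ⟨X₁, X₂, rfl⟩ := exists_tangentPair X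
    rw [mfderiv_prodMap_tangentPair h₁ h₂, doublyWarpedMetric_inner]
    have e₁ := g₁'.inner_normalPart φ₁ x.1 v₁ X₁
    have e₂ := g₂'.inner_normalPart φ₂ x.2 v₂ X₂
    simp only [Prod.map_fst, Prod.map_snd]
    rw [e₁, e₂]
    simp
  · obtain ⟨X₁, e₁⟩ := g₁'.exists_sub_normalPart (I := I₁) φ₁ x.1 v₁
    obtain ⟨X₂, e₂⟩ := g₂'.exists_sub_normalPart (I := I₂) φ₂ x.2 v₂
    refine ⟨tangentPair X₁ X₂, ?_⟩
    rw [mfderiv_prodMap_tangentPair h₁ h₂, ← e₁, ← e₂]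
    rfl

theorem normalGrad_log_fst (h₁ : ContMDiff I₁ J₁ ∞ φ₁) (h₂ : ContMDiff I₂ J₂ ∞ φ₂)
    (x : N₁ × N₂) :
    (doublyWarpedMetric g₁' g₂' ρ₁ ρ₂).normalGrad (I₁.prod I₂) (Prod.map φ₁ φ₂)
        (fun y => Real.log (ρ₁.toFun y.1)) x =
      tangentPair (x := Prod.map φ₁ φ₂ x) ((ρ₂.toFun (φ₂ x.2) ^ 2)⁻¹ •
        g₁'.normalGrad I₁ φ₁ (fun y => Real.log (ρ₁.toFun y)) x.1) 0 := by
  unfold Metric.normalGrad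
  rw [grad_comp_fst _ _ _ _ (mfderiv_log_comp ρ₁ _ 0).1]
  refine (normalPart_tangentPair g₁' g₂' ρ₁ ρ₂ h₁ h₂ x _ _).trans ?_
  rw [← g₁'.normalPart_smul]
  congr 1
  -- The normal part of 0 vanishes because 0 is the image of the zero vector.
  have := g₂'.normalPart_mfderiv (I := I₂) φ₂ x.2 0
  rwa [map_zero] at this

theorem normalGrad_log_snd (h₁ : ContMDiff I₁ J₁ ∞ φ₁) (h₂ : ContMDiff I₂ J₂ ∞ φ₂)
    (x : N₁ × N₂) :
    (doublyWarpedMetric g₁' g₂' ρ₁ ρ₂).normalGrad (I₁.prod I₂) (Prod.map φ₁ φ₂)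
        (fun y => Real.log (ρ₂.toFun y.2)) x =
      tangentPair (x := Prod.map φ₁ φ₂ x) 0 ((ρ₁.toFun (φ₁ x.1) ^ 2)⁻¹ •
        g₂'.normalGrad I₂ φ₂ (fun y => Real.log (ρ₂.toFun y)) x.2) := by
  unfold Metric.normalGrad
  rw [grad_comp_snd _ _ _ _ (mfderiv_log_comp ρ₂ _ 0).1]
  refine (normalPart_tangentPair g₁' g₂' ρ₁ ρ₂ h₁ h₂ x _ _).trans ?_
  rw [← g₂'.normalPart_smul]
  congr 1
  have := g₁'.normalPart_mfderiv (I := I₁) φ₁ x.1 0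
  rwa [map_zero] at this

/-- The second fundamental form of a doubly warped product immersion, in terms of those of the
factors and of the normal components `D ln ρᵢ`. -/
theorem secondForm_prodMap {g₁ : Metric I₁ N₁} {g₂ : Metric I₂ N₂}
    (hφ₁ : IsIsometricImmersion g₁ g₁' φ₁) (hφ₂ : IsIsometricImmersion g₂ g₂' φ₂) (x : N₁ × N₂)
    (X₁ Y₁ : TangentSpace I₁ x.1) (X₂ Y₂ : TangentSpace I₂ x.2) :
    (doublyWarpedMetric g₁' g₂' ρ₁ ρ₂).secondForm (I₁.prod I₂) (Prod.map φ₁ φ₂) x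
        (tangentPair X₁ X₂) (tangentPair Y₁ Y₂) =
      tangentPair (x := Prod.map φ₁ φ₂ x) (g₁'.secondForm I₁ φ₁ x.1 X₁ Y₁)
        (g₂'.secondForm I₂ φ₂ x.2 X₂ Y₂) +
      (-(ρ₂.toFun (φ₂ x.2) ^ 2 * g₁.inner x.1 X₁ Y₁)) •
        (doublyWarpedMetric g₁' g₂' ρ₁ ρ₂).normalGrad (I₁.prod I₂) (Prod.map φ₁ φ₂)
          (fun y => Real.log (ρ₂.toFun y.2)) x +
      (-(ρ₁.toFun (φ₁ x.1) ^ 2 * g₂.inner x.2 X₂ Y₂)) •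
        (doublyWarpedMetric g₁' g₂' ρ₁ ρ₂).normalGrad (I₁.prod I₂) (Prod.map φ₁ φ₂)
          (fun y => Real.log (ρ₁.toFun y.1)) x := by
  set g' := doublyWarpedMetric g₁' g₂' ρ₁ ρ₂
  set φ := Prod.map φ₁ φ₂
  have h₁ := hφ₁.contMDiff
  have h₂ := hφ₂.contMDiff
  -- `T₁` and `T₂` collect the terms of type (X₂ ln ρ₂) Y₁ of the connection. Their contribution is
  -- dφ of the pair (T₁, T₂), which the normal projection kills.
  let T₁ : TangentSpace I₁ x.1 :=
    ((ρ₂.toFun (φ₂ x.2))⁻¹ * ρ₂.deriv (φ₂ x.2) (mfderiv I₂ J₂ φ₂ x.2 X₂)) • Y₁ +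
      ((ρ₂.toFun (φ₂ x.2))⁻¹ * ρ₂.deriv (φ₂ x.2) (mfderiv I₂ J₂ φ₂ x.2 Y₂)) • X₁
  let T₂ : TangentSpace I₂ x.2 :=
    ((ρ₁.toFun (φ₁ x.1))⁻¹ * ρ₁.deriv (φ₁ x.1) (mfderiv I₁ J₁ φ₁ x.1 X₁)) • Y₂ +
      ((ρ₁.toFun (φ₁ x.1))⁻¹ * ρ₁.deriv (φ₁ x.1) (mfderiv I₁ J₁ φ₁ x.1 Y₁)) • X₂
  have key : g'.ambientDeriv (I₁.prod I₂) φ x (tangentPair X₁ X₂) (tangentPair Y₁ Y₂) =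
      tangentPair (x := Prod.map φ₁ φ₂ x) (g₁'.ambientDeriv I₁ φ₁ x.1 X₁ Y₁)
        (g₂'.ambientDeriv I₂ φ₂ x.2 X₂ Y₂) +
      mfderiv (I₁.prod I₂) (J₁.prod J₂) φ x (tangentPair T₁ T₂) +
      (-(ρ₂.toFun (φ₂ x.2) ^ 2 * g₁.inner x.1 X₁ Y₁)) •
        g'.grad (fun y => Real.log (ρ₂.toFun y.2)) (φ x) +
      (-(ρ₁.toFun (φ₁ x.1) ^ 2 * g₂.inner x.2 X₂ Y₂)) •
        g'.grad (fun y => Real.log (ρ₁.toFun y.1)) (φ x) := by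
    unfold Metric.ambientDeriv
    rw [chartHessian_prodMap h₁ h₂, mfderiv_prodMap_tangentPair h₁ h₂,
      mfderiv_prodMap_tangentPair h₁ h₂, mfderiv_prodMap_tangentPair h₁ h₂,
      christoffel_doublyWarpedMetric g₁' g₂' ρ₁ ρ₂ (Prod.map φ₁ φ₂ x), tangentPair_add,
      -- Turns g_i(X_i, Y_i) into g_i'(dφ_i X_i, dφ_i Y_i), the form in which the ambient connection
      -- produces it.
      ← hφ₁.isometric, ← hφ₂.isometric]
    simp only [T₁, T₂, map_add, map_smul]
    have e {V : Type _} [AddCommGroup V] [Module ℝ V] (A B C S T : V) (s t : ℝ) :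
        A + (B + C - (s • S + t • T)) = A + B + C + (-s) • S + (-t) • T := by module
    exact e ..
  rw [g'.secondForm_eq, key, g'.normalPart_add, g'.normalPart_add, g'.normalPart_add,
    g'.normalPart_smul, g'.normalPart_smul, g'.normalPart_mfderiv, add_zero,
    normalPart_tangentPair g₁' g₂' ρ₁ ρ₂ h₁ h₂]
  rfl

end

end ProductImmersion

/-! ### Independence of the orthonormal basis. -/

section Trace

variable {V : Type*} [AddCommGroup V] [Module ℝ V] [FiniteDimensional ℝ V]

/-- Pairing with e_j reads off the j-th coefficient, which gives independence; the cardinality then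
forces spanning. -/
theorem eq_sum_of_orthonormal {ι : Type*} [Fintype ι] [DecidableEq ι] (b : V →ₗ[ℝ] V →ₗ[ℝ] ℝ)
    {e : ι → V} (he : ∀ i j, b (e i) (e j) = if i = j then 1 else 0)
    (hc : Fintype.card ι = Module.finrank ℝ V) (v : V) : v = ∑ i, b v (e i) • e i := by
  have coord (c : ι → ℝ) (j : ι) : b (∑ i, c i • e i) (e j) = c j := by
    simp [LinearMap.sum_apply, he]
  have li : LinearIndependent ℝ e := by
    rw [Fintype.linearIndependent_iff]
    intro c h j
    rw [← coord c j, h, map_zero, LinearMap.zero_apply]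
  have hv : v ∈ Submodule.span ℝ (Set.range e) := by
    rw [li.span_eq_top_of_card_eq_finrank' hc]; trivial
  obtain ⟨c, rfl⟩ := (Submodule.mem_span_range_iff_exists_fun ℝ).1 hv
  simp only [coord]

/-- The trace of a bilinear form does not depend on the orthonormal basis. -/
theorem sum_apply_orthonormal_eq {ι κ : Type*} [Fintype ι] [DecidableEq ι] [Fintype κ]
    [DecidableEq κ] (b : V →ₗ[ℝ] V →ₗ[ℝ] ℝ) (symm : ∀ v w, b v w = b w v) {e : ι → V} {e' : κ → V}
    (he : ∀ i j, b (e i) (e j) = if i = j then 1 else 0)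
    (he' : ∀ i j, b (e' i) (e' j) = if i = j then 1 else 0)
    (hc : Fintype.card ι = Module.finrank ℝ V) (hc' : Fintype.card κ = Module.finrank ℝ V)
    (B : V →ₗ[ℝ] V →ₗ[ℝ] ℝ) : ∑ i, B (e i) (e i) = ∑ j, B (e' j) (e' j) := by
  calc ∑ i, B (e i) (e i) = ∑ i, ∑ j, b (e i) (e' j) * B (e i) (e' j) := by
        refine Finset.sum_congr rfl fun i _ => ?_
        refine (congrArg (B (e i)) (eq_sum_of_orthonormal b he' hc' (e i))).trans ?_
        simp
    _ = ∑ j, ∑ i, b (e i) (e' j) * B (e i) (e' j) := Finset.sum_comm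
    _ = ∑ j, B (e' j) (e' j) := by
        refine Finset.sum_congr rfl fun j _ => ?_
        refine Eq.trans ?_
          (congrArg (fun v => B v (e' j)) (eq_sum_of_orthonormal b he hc (e' j))).symm
        simp [LinearMap.sum_apply, symm (e' j)]

/-- The double sum is a trace in each slot separately, so the basis is changed in one slot at a
time. -/
theorem sum_sum_orthonormal_eq {W : Type*} [AddCommGroup W] [Module ℝ W] {ι κ : Type*} [Fintype ι]
    [DecidableEq ι] [Fintype κ] [DecidableEq κ] (b : V →ₗ[ℝ] V →ₗ[ℝ] ℝ)
    (symm : ∀ v w, b v w = b w v) {e : ι → V} {e' : κ → V}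
    (he : ∀ i j, b (e i) (e j) = if i = j then 1 else 0)
    (he' : ∀ i j, b (e' i) (e' j) = if i = j then 1 else 0)
    (hc : Fintype.card ι = Module.finrank ℝ V) (hc' : Fintype.card κ = Module.finrank ℝ V)
    (h : V →ₗ[ℝ] V →ₗ[ℝ] W) (Q : W →ₗ[ℝ] W →ₗ[ℝ] ℝ) :
    ∑ i, ∑ j, Q (h (e i) (e j)) (h (e i) (e j)) =
      ∑ i, ∑ j, Q (h (e' i) (e' j)) (h (e' i) (e' j)) := by
  calc ∑ i, ∑ j, Q (h (e i) (e j)) (h (e i) (e j))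
      = ∑ i, ∑ j, Q (h (e i) (e' j)) (h (e i) (e' j)) :=
        Finset.sum_congr rfl fun i _ =>
          sum_apply_orthonormal_eq b symm he he' hc hc' (Q.compl₁₂ (h (e i)) (h (e i)))
    _ = ∑ j, ∑ i, Q (h (e i) (e' j)) (h (e i) (e' j)) := Finset.sum_comm
    _ = ∑ j, ∑ i, Q (h (e' i) (e' j)) (h (e' i) (e' j)) :=
        Finset.sum_congr rfl fun j _ => sum_apply_orthonormal_eq b symm he he' hc hc'
          (Q.compl₁₂ (h.flip (e' j)) (h.flip (e' j)))
    _ = _ := Finset.sum_comm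

end Trace

/-! ### The squared norm of a second fundamental form. -/

section NormSq

set_option linter.unusedSectionVars false

variable {E : Type*} [NormedAddCommGroup E] [NormedSpace ℝ E] [FiniteDimensional ℝ E]
  {H : Type*} [TopologicalSpace H] {I : ModelWithCorners ℝ E H}
  {M : Type*} [TopologicalSpace M] [ChartedSpace H M] [IsManifold I ∞ M]
  {E' : Type*} [NormedAddCommGroup E'] [NormedSpace ℝ E'] [FiniteDimensional ℝ E']
  {H' : Type*} [TopologicalSpace H'] {I' : ModelWithCorners ℝ E' H'}
  {M' : Type*} [TopologicalSpace M'] [ChartedSpace H' M'] [IsManifold I' ∞ M']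

theorem Metric.orthonormalBasis_inner (g : Metric I M) (p : M) (i j : Fin (Module.finrank ℝ E)) :
    g.inner p (g.orthonormalBasis p i) (g.orthonormalBasis p j) = if i = j then 1 else 0 :=
  (g.exists_orthonormalBasis p).choose_spec i j

theorem Metric.normSq_smul (g : Metric I M) (p : M) (c : ℝ) (v : TangentSpace I p) :
    g.normSq p (c • v) = c ^ 2 * g.normSq p v := by
  simp only [Metric.normSq, map_smul, smul_apply, smul_eq_mul]
  ring

/-- The squared norm of the second fundamental form may be computed in any orthonormal basis. -/
theorem secondFormNormSq_eq_sum (g : Metric I M) (g' : Metric I' M') (φ : M → M') (p : M)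
    {ι : Type*} [Fintype ι] [DecidableEq ι] (hc : Fintype.card ι = Module.finrank ℝ E)
    {e : ι → TangentSpace I p} (he : ∀ i j, g.inner p (e i) (e j) = if i = j then 1 else 0) :
    secondFormNormSq g g' φ p = ∑ i, ∑ j, g'.normSq (φ p) (g'.secondForm I φ p (e i) (e j)) :=
  have : FiniteDimensional ℝ (TangentSpace I p) := inferInstanceAs (FiniteDimensional ℝ E)
  sum_sum_orthonormal_eq (V := TangentSpace I p) (g.form p) (g.symm p)
    (g.orthonormalBasis_inner p) he (Fintype.card_fin _) hc (g'.secondFormBilin I φ p)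
    (g'.form (φ p))

theorem secondFormNormSq_nonneg (g : Metric I M) (g' : Metric I' M') (φ : M → M') (p : M) :
    0 ≤ secondFormNormSq g g' φ p :=
  Finset.sum_nonneg fun _ _ => Finset.sum_nonneg fun _ _ => g'.normSq_nonneg _ _

/-- A sum of nonnegative terms vanishes only termwise, and bilinearity carries the vanishing from
the basis to all vectors. -/
theorem secondFormNormSq_eq_zero (g : Metric I M) (g' : Metric I' M') (φ : M → M') (p : M) :
    secondFormNormSq g g' φ p = 0 ↔ ∀ X Y : TangentSpace I p, g'.secondForm I φ p X Y = 0 := by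
  have : FiniteDimensional ℝ (TangentSpace I p) := inferInstanceAs (FiniteDimensional ℝ E)
  constructor
  · intro h X Y
    have h₀ (i j) : g'.secondFormBilin I φ p (g.orthonormalBasis p i) (g.orthonormalBasis p j)
        = 0 := by
      have h₁ := (Finset.sum_eq_zero_iff_of_nonneg fun _ _ =>
        Finset.sum_nonneg fun _ _ => g'.normSq_nonneg _ _).1 h i (Finset.mem_univ i)
      have h₂ := (Finset.sum_eq_zero_iff_of_nonneg fun _ _ =>
        g'.normSq_nonneg _ _).1 h₁ j (Finset.mem_univ j)
      exact g'.normSq_eq_zero.1 h₂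
    have ex := eq_sum_of_orthonormal (V := TangentSpace I p) (g.form p)
      (g.orthonormalBasis_inner p) (Fintype.card_fin _)
    rw [← g'.secondFormBilin_apply, ex X, ex Y]
    simp [h₀, LinearMap.sum_apply]
  · intro h
    simp [secondFormNormSq, h, Metric.normSq]

end NormSq

/-! ### Pythagoras and the norm formula for a product immersion. -/

section ProductImmersion

set_option linter.unusedSectionVars false

variable {E₁ : Type*} [NormedAddCommGroup E₁] [NormedSpace ℝ E₁] [FiniteDimensional ℝ E₁]
  {H₁ : Type*} [TopologicalSpace H₁] {I₁ : ModelWithCorners ℝ E₁ H₁} [I₁.Boundaryless]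
  {N₁ : Type*} [TopologicalSpace N₁] [ChartedSpace H₁ N₁] [IsManifold I₁ ∞ N₁]
  {E₂ : Type*} [NormedAddCommGroup E₂] [NormedSpace ℝ E₂] [FiniteDimensional ℝ E₂]
  {H₂ : Type*} [TopologicalSpace H₂] {I₂ : ModelWithCorners ℝ E₂ H₂} [I₂.Boundaryless]
  {N₂ : Type*} [TopologicalSpace N₂] [ChartedSpace H₂ N₂] [IsManifold I₂ ∞ N₂]
  {F₁ : Type*} [NormedAddCommGroup F₁] [NormedSpace ℝ F₁] [FiniteDimensional ℝ F₁]
  {K₁ : Type*} [TopologicalSpace K₁] {J₁ : ModelWithCorners ℝ F₁ K₁} [J₁.Boundaryless]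
  {M₁ : Type*} [TopologicalSpace M₁] [ChartedSpace K₁ M₁] [IsManifold J₁ ∞ M₁]
  {F₂ : Type*} [NormedAddCommGroup F₂] [NormedSpace ℝ F₂] [FiniteDimensional ℝ F₂]
  {K₂ : Type*} [TopologicalSpace K₂] {J₂ : ModelWithCorners ℝ F₂ K₂} [J₂.Boundaryless]
  {M₂ : Type*} [TopologicalSpace M₂] [ChartedSpace K₂ M₂] [IsManifold J₂ ∞ M₂]

section NormalGradLog

variable (I₁ I₂) (g₁' : Metric J₁ M₁) (g₂' : Metric J₂ M₂) (ρ₁ : WarpingFunction J₁ M₁)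
  (ρ₂ : WarpingFunction J₂ M₂) (φ₁ : N₁ → M₁) (φ₂ : N₂ → M₂) (x : N₁ × N₂)

/-- `D ln ρ₁` for a product immersion into a doubly warped product. -/
def normalGradLogFst : TangentSpace (J₁.prod J₂) (Prod.map φ₁ φ₂ x) :=
  (doublyWarpedMetric g₁' g₂' ρ₁ ρ₂).normalGrad (I₁.prod I₂) (Prod.map φ₁ φ₂)
    (fun y => Real.log (ρ₁.toFun y.1)) x

/-- `D ln ρ₂` for a product immersion into a doubly warped product. -/
def normalGradLogSnd : TangentSpace (J₁.prod J₂) (Prod.map φ₁ φ₂ x) :=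
  (doublyWarpedMetric g₁' g₂' ρ₁ ρ₂).normalGrad (I₁.prod I₂) (Prod.map φ₁ φ₂)
    (fun y => Real.log (ρ₂.toFun y.2)) x

end NormalGradLog

variable {φ₁ : N₁ → M₁} {φ₂ : N₂ → M₂} {g₁ : Metric I₁ N₁} {g₂ : Metric I₂ N₂}
  {g₁' : Metric J₁ M₁} {g₂' : Metric J₂ M₂} (ρ₁ : WarpingFunction J₁ M₁)
  (ρ₂ : WarpingFunction J₂ M₂)

theorem secondForm_prodMap_mixed (hφ₁ : IsIsometricImmersion g₁ g₁' φ₁)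
    (hφ₂ : IsIsometricImmersion g₂ g₂' φ₂) (x : N₁ × N₂) (X : TangentSpace I₁ x.1) (Z : TangentSpace I₂ x.2) :
    (doublyWarpedMetric g₁' g₂' ρ₁ ρ₂).secondForm (I₁.prod I₂) (Prod.map φ₁ φ₂) x
      (tangentPair X 0) (tangentPair 0 Z) = 0 := by
  rw [secondForm_prodMap g₁' g₂' ρ₁ ρ₂ hφ₁ hφ₂, g₁'.secondForm_zero_right, g₂'.secondForm_zero_left,
    map_zero, map_zero, zero_apply]
  simp only [mul_zero, neg_zero, zero_smul, add_zero]
  rfl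

/-- The reversed order is needed for the double sum over a basis; symmetry of h is not invoked. -/
theorem secondForm_prodMap_mixed' (hφ₁ : IsIsometricImmersion g₁ g₁' φ₁)
    (hφ₂ : IsIsometricImmersion g₂ g₂' φ₂) (x : N₁ × N₂) (X : TangentSpace I₁ x.1) (Z : TangentSpace I₂ x.2) :
    (doublyWarpedMetric g₁' g₂' ρ₁ ρ₂).secondForm (I₁.prod I₂) (Prod.map φ₁ φ₂) x
      (tangentPair 0 Z) (tangentPair X 0) = 0 := by
  rw [secondForm_prodMap g₁' g₂' ρ₁ ρ₂ hφ₁ hφ₂, g₁'.secondForm_zero_left, g₂'.secondForm_zero_right,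
    map_zero, map_zero, zero_apply]
  simp only [mul_zero, neg_zero, zero_smul, add_zero]
  rfl

theorem secondForm_prodMap_first (hφ₁ : IsIsometricImmersion g₁ g₁' φ₁)
    (hφ₂ : IsIsometricImmersion g₂ g₂' φ₂) (x : N₁ × N₂) (X Y : TangentSpace I₁ x.1) :
    (doublyWarpedMetric g₁' g₂' ρ₁ ρ₂).secondForm (I₁.prod I₂) (Prod.map φ₁ φ₂) x
      (tangentPair X 0) (tangentPair Y 0) =
      tangentPair (x := Prod.map φ₁ φ₂ x) (g₁'.secondForm I₁ φ₁ x.1 X Y) 0 +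
        (-(ρ₂.toFun (φ₂ x.2) ^ 2 * g₁.inner x.1 X Y)) •
          normalGradLogSnd I₁ I₂ g₁' g₂' ρ₁ ρ₂ φ₁ φ₂ x := by
  rw [secondForm_prodMap g₁' g₂' ρ₁ ρ₂ hφ₁ hφ₂, g₂'.secondForm_zero_left,
    map_zero (g₂.inner x.2), zero_apply, mul_zero, neg_zero, zero_smul, add_zero]
  rfl

theorem secondForm_prodMap_second (hφ₁ : IsIsometricImmersion g₁ g₁' φ₁)
    (hφ₂ : IsIsometricImmersion g₂ g₂' φ₂) (x : N₁ × N₂) (Z W : TangentSpace I₂ x.2) :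
    (doublyWarpedMetric g₁' g₂' ρ₁ ρ₂).secondForm (I₁.prod I₂) (Prod.map φ₁ φ₂) x
      (tangentPair 0 Z) (tangentPair 0 W) =
      tangentPair (x := Prod.map φ₁ φ₂ x) 0 (g₂'.secondForm I₂ φ₂ x.2 Z W) +
        (-(ρ₁.toFun (φ₁ x.1) ^ 2 * g₂.inner x.2 Z W)) •
          normalGradLogFst I₁ I₂ g₁' g₂' ρ₁ ρ₂ φ₁ φ₂ x := by
  rw [secondForm_prodMap g₁' g₂' ρ₁ ρ₂ hφ₁ hφ₂, g₁'.secondForm_zero_left,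
    map_zero (g₁.inner x.1), zero_apply, mul_zero, neg_zero, zero_smul, add_zero]
  rfl

/-- Pythagoras: D ln ρ₂ lies in the second factor, orthogonal to (v, 0). -/
theorem normSq_add_smul_normalGradLogSnd (hφ₁ : IsIsometricImmersion g₁ g₁' φ₁)
    (hφ₂ : IsIsometricImmersion g₂ g₂' φ₂) (x : N₁ × N₂) (v : TangentSpace J₁ (φ₁ x.1)) (c : ℝ) :
    (doublyWarpedMetric g₁' g₂' ρ₁ ρ₂).normSq (Prod.map φ₁ φ₂ x)
        (tangentPair (x := Prod.map φ₁ φ₂ x) v 0 +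
          c • normalGradLogSnd I₁ I₂ g₁' g₂' ρ₁ ρ₂ φ₁ φ₂ x) =
      ρ₂.toFun (φ₂ x.2) ^ 2 * g₁'.normSq (φ₁ x.1) v +
        c ^ 2 * (doublyWarpedMetric g₁' g₂' ρ₁ ρ₂).normSq (Prod.map φ₁ φ₂ x)
          (normalGradLogSnd I₁ I₂ g₁' g₂' ρ₁ ρ₂ φ₁ φ₂ x) := by
  have e := normalGrad_log_snd g₁' g₂' ρ₁ ρ₂ hφ₁.contMDiff hφ₂.contMDiff x
  unfold normalGradLogSnd
  rw [e, smul_tangentPair, ← tangentPair_add, doublyWarpedMetric_normSq, doublyWarpedMetric_normSq,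
    smul_zero, add_zero, zero_add, g₂'.normSq_smul, g₁'.normSq_eq_zero.2 rfl]
  simp only [Prod.map_fst, Prod.map_snd]
  ring

theorem normSq_add_smul_normalGradLogFst (hφ₁ : IsIsometricImmersion g₁ g₁' φ₁)
    (hφ₂ : IsIsometricImmersion g₂ g₂' φ₂) (x : N₁ × N₂) (v : TangentSpace J₂ (φ₂ x.2)) (c : ℝ) :
    (doublyWarpedMetric g₁' g₂' ρ₁ ρ₂).normSq (Prod.map φ₁ φ₂ x)
        (tangentPair (x := Prod.map φ₁ φ₂ x) 0 v +
          c • normalGradLogFst I₁ I₂ g₁' g₂' ρ₁ ρ₂ φ₁ φ₂ x) =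
      ρ₁.toFun (φ₁ x.1) ^ 2 * g₂'.normSq (φ₂ x.2) v +
        c ^ 2 * (doublyWarpedMetric g₁' g₂' ρ₁ ρ₂).normSq (Prod.map φ₁ φ₂ x)
          (normalGradLogFst I₁ I₂ g₁' g₂' ρ₁ ρ₂ φ₁ φ₂ x) := by
  have e := normalGrad_log_fst g₁' g₂' ρ₁ ρ₂ hφ₁.contMDiff hφ₂.contMDiff x
  unfold normalGradLogFst
  rw [e, smul_tangentPair, ← tangentPair_add, doublyWarpedMetric_normSq, doublyWarpedMetric_normSq,
    smul_zero, add_zero, zero_add, g₁'.normSq_smul, g₂'.normSq_eq_zero.2 rfl]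
  simp only [Prod.map_fst, Prod.map_snd]
  ring

/-- The squared length of h(X, Y) is a sum of two nonnegative terms, one from h₁ and one from D ln
ρ₂, so no cancellation between them is possible. -/
theorem secondForm_prodMap_first_eq_zero (hφ₁ : IsIsometricImmersion g₁ g₁' φ₁)
    (hφ₂ : IsIsometricImmersion g₂ g₂' φ₂) (x : N₁ × N₂) (X Y : TangentSpace I₁ x.1) :
    (doublyWarpedMetric g₁' g₂' ρ₁ ρ₂).secondForm (I₁.prod I₂) (Prod.map φ₁ φ₂) x
        (tangentPair X 0) (tangentPair Y 0) = 0 ↔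
      g₁'.secondForm I₁ φ₁ x.1 X Y = 0 ∧
        (g₁.inner x.1 X Y = 0 ∨ normalGradLogSnd I₁ I₂ g₁' g₂' ρ₁ ρ₂ φ₁ φ₂ x = 0) := by
  have h := (ρ₂.pos (φ₂ x.2)).ne'
  rw [← Metric.normSq_eq_zero (doublyWarpedMetric g₁' g₂' ρ₁ ρ₂),
    secondForm_prodMap_first ρ₁ ρ₂ hφ₁ hφ₂, normSq_add_smul_normalGradLogSnd ρ₁ ρ₂ hφ₁ hφ₂,
    add_eq_zero_iff_of_nonneg (mul_nonneg (sq_nonneg _) (g₁'.normSq_nonneg _ _))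
      (mul_nonneg (sq_nonneg _) (Metric.normSq_nonneg _ _ _)),
    mul_eq_zero, mul_eq_zero, g₁'.normSq_eq_zero, Metric.normSq_eq_zero]
  simp [h]

theorem secondForm_prodMap_second_eq_zero (hφ₁ : IsIsometricImmersion g₁ g₁' φ₁)
    (hφ₂ : IsIsometricImmersion g₂ g₂' φ₂) (x : N₁ × N₂) (Z W : TangentSpace I₂ x.2) :
    (doublyWarpedMetric g₁' g₂' ρ₁ ρ₂).secondForm (I₁.prod I₂) (Prod.map φ₁ φ₂) x
        (tangentPair 0 Z) (tangentPair 0 W) = 0 ↔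
      g₂'.secondForm I₂ φ₂ x.2 Z W = 0 ∧
        (g₂.inner x.2 Z W = 0 ∨ normalGradLogFst I₁ I₂ g₁' g₂' ρ₁ ρ₂ φ₁ φ₂ x = 0) := by
  have h := (ρ₁.pos (φ₁ x.1)).ne'
  rw [← Metric.normSq_eq_zero (doublyWarpedMetric g₁' g₂' ρ₁ ρ₂),
    secondForm_prodMap_second ρ₁ ρ₂ hφ₁ hφ₂, normSq_add_smul_normalGradLogFst ρ₁ ρ₂ hφ₁ hφ₂,
    add_eq_zero_iff_of_nonneg (mul_nonneg (sq_nonneg _) (g₂'.normSq_nonneg _ _))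
      (mul_nonneg (sq_nonneg _) (Metric.normSq_nonneg _ _ _)),
    mul_eq_zero, mul_eq_zero, g₂'.normSq_eq_zero, Metric.normSq_eq_zero]
  simp [h]

/-- The squared norm of the second fundamental form of a doubly warped product immersion. -/
theorem secondFormNormSq_prodMap (hφ₁ : IsIsometricImmersion g₁ g₁' φ₁)
    (hφ₂ : IsIsometricImmersion g₂ g₂' φ₂) (x : N₁ × N₂) :
    secondFormNormSq (doublyWarpedMetric g₁ g₂ (ρ₁.comp φ₁ hφ₁.contMDiff)
        (ρ₂.comp φ₂ hφ₂.contMDiff)) (doublyWarpedMetric g₁' g₂' ρ₁ ρ₂) (Prod.map φ₁ φ₂) x =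
      (ρ₂.toFun (φ₂ x.2) ^ 2)⁻¹ * secondFormNormSq g₁ g₁' φ₁ x.1 +
      (ρ₁.toFun (φ₁ x.1) ^ 2)⁻¹ * secondFormNormSq g₂ g₂' φ₂ x.2 +
      (Module.finrank ℝ E₁ * (doublyWarpedMetric g₁' g₂' ρ₁ ρ₂).normSq (Prod.map φ₁ φ₂ x)
          (normalGradLogSnd I₁ I₂ g₁' g₂' ρ₁ ρ₂ φ₁ φ₂ x) +
        Module.finrank ℝ E₂ * (doublyWarpedMetric g₁' g₂' ρ₁ ρ₂).normSq (Prod.map φ₁ φ₂ x)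
          (normalGradLogFst I₁ I₂ g₁' g₂' ρ₁ ρ₂ φ₁ φ₂ x)) := by
  have k₁ := (ρ₁.pos (φ₁ x.1)).ne'
  have k₂ := (ρ₂.pos (φ₂ x.2)).ne'
  -- On the first factor the product metric is f₂² g₁, so a g₁-orthonormal basis is divided by f₂ to
  -- stay orthonormal; similarly for the second.
  let e₁ (i : Fin (Module.finrank ℝ E₁)) : TangentSpace I₁ x.1 :=
    (ρ₂.toFun (φ₂ x.2))⁻¹ • g₁.orthonormalBasis x.1 i
  let e₂ (i : Fin (Module.finrank ℝ E₂)) : TangentSpace I₂ x.2 :=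
    (ρ₁.toFun (φ₁ x.1))⁻¹ • g₂.orthonormalBasis x.2 i
  let e : Fin (Module.finrank ℝ E₁) ⊕ Fin (Module.finrank ℝ E₂) → TangentSpace (I₁.prod I₂) x :=
    Sum.elim (fun i => tangentPair (e₁ i) 0) (fun i => tangentPair 0 (e₂ i))
  have o₁ (i j) : g₁.inner x.1 (e₁ i) (e₁ j) =
      (ρ₂.toFun (φ₂ x.2) ^ 2)⁻¹ * if i = j then 1 else 0 := by
    rw [← g₁.orthonormalBasis_inner x.1]
    simp only [e₁, map_smul, smul_apply, smul_eq_mul]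
    ring
  have o₂ (i j) : g₂.inner x.2 (e₂ i) (e₂ j) =
      (ρ₁.toFun (φ₁ x.1) ^ 2)⁻¹ * if i = j then 1 else 0 := by
    rw [← g₂.orthonormalBasis_inner x.2]
    simp only [e₂, map_smul, smul_apply, smul_eq_mul]
    ring
  have he (a b) : (doublyWarpedMetric g₁ g₂ (ρ₁.comp φ₁ hφ₁.contMDiff)
      (ρ₂.comp φ₂ hφ₂.contMDiff)).inner x (e a) (e b) = if a = b then 1 else 0 := by
    rcases a with i | i <;> rcases b with j | j <;>
      simp only [e, Sum.elim_inl, Sum.elim_inr, doublyWarpedMetric_inner, o₁, o₂, map_zero,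
        zero_apply, mul_zero, add_zero, zero_add, WarpingFunction.comp, Function.comp] <;>
      simp [k₁, k₂]
  -- The two rescaled arguments give f₂⁻⁴ ‖h₁‖² and the ambient metric f₂², leaving f₂⁻². In the
  -- coefficient of D ln ρ₂ the powers cancel to -δ_ij, whose square is δ_ij, so only the diagonal
  -- contributes: n₁ times in all.
  have s₁ (i j) : (doublyWarpedMetric g₁' g₂' ρ₁ ρ₂).normSq (Prod.map φ₁ φ₂ x)
      ((doublyWarpedMetric g₁' g₂' ρ₁ ρ₂).secondForm (I₁.prod I₂) (Prod.map φ₁ φ₂) x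
        (e (Sum.inl i)) (e (Sum.inl j))) =
      (ρ₂.toFun (φ₂ x.2) ^ 2)⁻¹ * g₁'.normSq (φ₁ x.1) (g₁'.secondForm I₁ φ₁ x.1
        (g₁.orthonormalBasis x.1 i) (g₁.orthonormalBasis x.1 j)) +
      (if i = j then 1 else 0) * (doublyWarpedMetric g₁' g₂' ρ₁ ρ₂).normSq (Prod.map φ₁ φ₂ x)
        (normalGradLogSnd I₁ I₂ g₁' g₂' ρ₁ ρ₂ φ₁ φ₂ x) := by
    simp only [e, Sum.elim_inl]
    rw [secondForm_prodMap_first ρ₁ ρ₂ hφ₁ hφ₂, normSq_add_smul_normalGradLogSnd ρ₁ ρ₂ hφ₁ hφ₂, o₁,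
      g₁'.secondForm_smul_smul, g₁'.normSq_smul]
    split_ifs <;> field_simp
    ring
  have s₂ (i j) : (doublyWarpedMetric g₁' g₂' ρ₁ ρ₂).normSq (Prod.map φ₁ φ₂ x)
      ((doublyWarpedMetric g₁' g₂' ρ₁ ρ₂).secondForm (I₁.prod I₂) (Prod.map φ₁ φ₂) x
        (e (Sum.inr i)) (e (Sum.inr j))) =
      (ρ₁.toFun (φ₁ x.1) ^ 2)⁻¹ * g₂'.normSq (φ₂ x.2) (g₂'.secondForm I₂ φ₂ x.2
        (g₂.orthonormalBasis x.2 i) (g₂.orthonormalBasis x.2 j)) +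
      (if i = j then 1 else 0) * (doublyWarpedMetric g₁' g₂' ρ₁ ρ₂).normSq (Prod.map φ₁ φ₂ x)
        (normalGradLogFst I₁ I₂ g₁' g₂' ρ₁ ρ₂ φ₁ φ₂ x) := by
    simp only [e, Sum.elim_inr]
    rw [secondForm_prodMap_second ρ₁ ρ₂ hφ₁ hφ₂, normSq_add_smul_normalGradLogFst ρ₁ ρ₂ hφ₁ hφ₂, o₂,
      g₂'.secondForm_smul_smul, g₂'.normSq_smul]
    split_ifs <;> field_simp
    ring
  have m₁ (i j) : (doublyWarpedMetric g₁' g₂' ρ₁ ρ₂).normSq (Prod.map φ₁ φ₂ x)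
      ((doublyWarpedMetric g₁' g₂' ρ₁ ρ₂).secondForm (I₁.prod I₂) (Prod.map φ₁ φ₂) x
        (e (Sum.inl i)) (e (Sum.inr j))) = 0 :=
    (Metric.normSq_eq_zero _).2 (secondForm_prodMap_mixed ρ₁ ρ₂ hφ₁ hφ₂ x _ _)
  have m₂ (i j) : (doublyWarpedMetric g₁' g₂' ρ₁ ρ₂).normSq (Prod.map φ₁ φ₂ x)
      ((doublyWarpedMetric g₁' g₂' ρ₁ ρ₂).secondForm (I₁.prod I₂) (Prod.map φ₁ φ₂) x
        (e (Sum.inr i)) (e (Sum.inl j))) = 0 :=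
    (Metric.normSq_eq_zero _).2 (secondForm_prodMap_mixed' ρ₁ ρ₂ hφ₁ hφ₂ x _ _)
  rw [secondFormNormSq_eq_sum _ _ _ _ (by simp) he]
  simp only [Fintype.sum_sum_type, s₁, s₂, m₁, m₂, Finset.sum_add_distrib, Finset.sum_const_zero,
    add_zero, zero_add, secondFormNormSq, ← Finset.mul_sum, ← Finset.sum_mul, Finset.sum_ite_eq,
    Finset.mem_univ, if_true, Finset.sum_const, Finset.card_univ, Fintype.card_fin, nsmul_eq_mul]
  ring

end ProductImmersion

end DWP

end

/-! ### The theorem. -/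

theorem mainTheorem1
    {E₁ : Type*} [NormedAddCommGroup E₁] [NormedSpace ℝ E₁] [FiniteDimensional ℝ E₁]
    {H₁ : Type*} [TopologicalSpace H₁] {I₁ : ModelWithCorners ℝ E₁ H₁} [I₁.Boundaryless]
    {N₁ : Type*} [TopologicalSpace N₁] [ChartedSpace H₁ N₁] [IsManifold I₁ ∞ N₁] [Nonempty N₁]
    {E₂ : Type*} [NormedAddCommGroup E₂] [NormedSpace ℝ E₂] [FiniteDimensional ℝ E₂]
    {H₂ : Type*} [TopologicalSpace H₂] {I₂ : ModelWithCorners ℝ E₂ H₂} [I₂.Boundaryless]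
    {N₂ : Type*} [TopologicalSpace N₂] [ChartedSpace H₂ N₂] [IsManifold I₂ ∞ N₂] [Nonempty N₂]
    {F₁ : Type*} [NormedAddCommGroup F₁] [NormedSpace ℝ F₁] [FiniteDimensional ℝ F₁]
    {K₁ : Type*} [TopologicalSpace K₁] {J₁ : ModelWithCorners ℝ F₁ K₁} [J₁.Boundaryless]
    {M₁ : Type*} [TopologicalSpace M₁] [ChartedSpace K₁ M₁] [IsManifold J₁ ∞ M₁]
    {F₂ : Type*} [NormedAddCommGroup F₂] [NormedSpace ℝ F₂] [FiniteDimensional ℝ F₂]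
    {K₂ : Type*} [TopologicalSpace K₂] {J₂ : ModelWithCorners ℝ F₂ K₂} [J₂.Boundaryless]
    {M₂ : Type*} [TopologicalSpace M₂] [ChartedSpace K₂ M₂] [IsManifold J₂ ∞ M₂]
    (g₁ : DWP.Metric I₁ N₁) (g₂ : DWP.Metric I₂ N₂) (g₁' : DWP.Metric J₁ M₁) (g₂' : DWP.Metric J₂ M₂)
    (ρ₁ : DWP.WarpingFunction J₁ M₁) (ρ₂ : DWP.WarpingFunction J₂ M₂)
    (φ₁ : N₁ → M₁) (φ₂ : N₂ → M₂)
    (hφ₁ : DWP.IsIsometricImmersion g₁ g₁' φ₁) (hφ₂ : DWP.IsIsometricImmersion g₂ g₂' φ₂) :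
    let φ : N₁ × N₂ → M₁ × M₂ := Prod.map φ₁ φ₂
    let f₁ : DWP.WarpingFunction I₁ N₁ := ρ₁.comp φ₁ hφ₁.contMDiff
    let f₂ : DWP.WarpingFunction I₂ N₂ := ρ₂.comp φ₂ hφ₂.contMDiff
    let g : DWP.Metric (I₁.prod I₂) (N₁ × N₂) := DWP.doublyWarpedMetric g₁ g₂ f₁ f₂
    let g' : DWP.Metric (J₁.prod J₂) (M₁ × M₂) := DWP.doublyWarpedMetric g₁' g₂' ρ₁ ρ₂
    let n₁ : ℕ := Module.finrank ℝ E₁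
    let n₂ : ℕ := Module.finrank ℝ E₂
    let D₁ : (x : N₁ × N₂) → TangentSpace (J₁.prod J₂) (φ x) :=
      g'.normalGrad (I₁.prod I₂) φ (fun y => Real.log (ρ₁.toFun y.1))
    let D₂ : (x : N₁ × N₂) → TangentSpace (J₁.prod J₂) (φ x) :=
      g'.normalGrad (I₁.prod I₂) φ (fun y => Real.log (ρ₂.toFun y.2))
    g'.IsMixedTotallyGeodesic I₁ I₂ φ ∧
    ((∀ x, n₁ * g'.normSq (φ x) (D₂ x) + n₂ * g'.normSq (φ x) (D₁ x) ≤
        DWP.secondFormNormSq g g' φ x) ∧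
      ((∀ x, DWP.secondFormNormSq g g' φ x =
          n₁ * g'.normSq (φ x) (D₂ x) + n₂ * g'.normSq (φ x) (D₁ x)) ↔
        g₁'.IsTotallyGeodesic I₁ φ₁ ∧ g₂'.IsTotallyGeodesic I₂ φ₂)) ∧
    ((0 < n₁ → (g'.IsFirstTotallyGeodesic I₁ I₂ φ ↔
        g₁'.IsTotallyGeodesic I₁ φ₁ ∧ ∀ x, D₂ x = 0)) ∧
      (0 < n₂ → (g'.IsSecondTotallyGeodesic I₁ I₂ φ ↔
        g₂'.IsTotallyGeodesic I₂ φ₂ ∧ ∀ x, D₁ x = 0))) ∧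
    (g'.IsTotallyGeodesic (I₁.prod I₂) φ ↔
      g'.IsFirstTotallyGeodesic I₁ I₂ φ ∧ g'.IsSecondTotallyGeodesic I₁ I₂ φ) := by
  intro φ f₁ f₂ g g' n₁ n₂ D₁ D₂
  have first (x : N₁ × N₂) (X Y : TangentSpace I₁ x.1) :
      g'.secondForm (I₁.prod I₂) φ x (DWP.tangentPair X 0) (DWP.tangentPair Y 0) = 0 ↔
        g₁'.secondForm I₁ φ₁ x.1 X Y = 0 ∧ (g₁.inner x.1 X Y = 0 ∨ D₂ x = 0) :=
    DWP.secondForm_prodMap_first_eq_zero ρ₁ ρ₂ hφ₁ hφ₂ x X Y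
  have second (x : N₁ × N₂) (Z W : TangentSpace I₂ x.2) :
      g'.secondForm (I₁.prod I₂) φ x (DWP.tangentPair 0 Z) (DWP.tangentPair 0 W) = 0 ↔
        g₂'.secondForm I₂ φ₂ x.2 Z W = 0 ∧ (g₂.inner x.2 Z W = 0 ∨ D₁ x = 0) :=
    DWP.secondForm_prodMap_second_eq_zero ρ₁ ρ₂ hφ₁ hφ₂ x Z W
  have norm (x : N₁ × N₂) : DWP.secondFormNormSq g g' φ x =
      (ρ₂.toFun (φ₂ x.2) ^ 2)⁻¹ * DWP.secondFormNormSq g₁ g₁' φ₁ x.1 +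
      (ρ₁.toFun (φ₁ x.1) ^ 2)⁻¹ * DWP.secondFormNormSq g₂ g₂' φ₂ x.2 +
      (n₁ * g'.normSq (φ x) (D₂ x) + n₂ * g'.normSq (φ x) (D₁ x)) :=
    DWP.secondFormNormSq_prodMap ρ₁ ρ₂ hφ₁ hφ₂ x
  have nonneg₁ (x : N₁ × N₂) :
      0 ≤ (ρ₂.toFun (φ₂ x.2) ^ 2)⁻¹ * DWP.secondFormNormSq g₁ g₁' φ₁ x.1 :=
    mul_nonneg (by positivity) (DWP.secondFormNormSq_nonneg _ _ _ _)
  have nonneg₂ (x : N₁ × N₂) :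
      0 ≤ (ρ₁.toFun (φ₁ x.1) ^ 2)⁻¹ * DWP.secondFormNormSq g₂ g₂' φ₂ x.2 :=
    mul_nonneg (by positivity) (DWP.secondFormNormSq_nonneg _ _ _ _)
  refine ⟨DWP.secondForm_prodMap_mixed ρ₁ ρ₂ hφ₁ hφ₂,
    ⟨fun x => ?_, fun h => ?_, fun h x => ?_⟩, ⟨fun hn => ⟨fun h => ?_, fun h x X Y => ?_⟩,
      fun hn => ⟨fun h => ?_, fun h x Z W => ?_⟩⟩, fun h => ?_, fun h => ?_⟩
  · linarith [norm x, nonneg₁ x, nonneg₂ x]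
  -- Equality says that the two nonnegative terms f₂⁻² ‖h₁‖² and f₁⁻² ‖h₂‖² have sum zero.
  · have vanish (x : N₁ × N₂) : DWP.secondFormNormSq g₁ g₁' φ₁ x.1 = 0 ∧
        DWP.secondFormNormSq g₂ g₂' φ₂ x.2 = 0 := by
      have e := (norm x).symm.trans (h x)
      have p₁ := (ρ₁.pos (φ₁ x.1)).ne'
      have p₂ := (ρ₂.pos (φ₂ x.2)).ne'
      have := (add_eq_zero_iff_of_nonneg (nonneg₁ x) (nonneg₂ x)).1 (by linarith)
      simpa [p₁, p₂] using this
    -- A point of one factor is seen by the product only when paired with a point of the other,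
    -- hence the need for both to be non-empty.
    obtain ⟨a⟩ := ‹Nonempty N₁›
    obtain ⟨b⟩ := ‹Nonempty N₂›
    exact ⟨fun p => (DWP.secondFormNormSq_eq_zero ..).1 (vanish (p, b)).1,
      fun q => (DWP.secondFormNormSq_eq_zero ..).1 (vanish (a, q)).2⟩
  · rw [norm x, (DWP.secondFormNormSq_eq_zero g₁ g₁' φ₁ x.1).2 (h.1 x.1),
      (DWP.secondFormNormSq_eq_zero g₂ g₂' φ₂ x.2).2 (h.2 x.2)]
    ring
  · obtain ⟨b⟩ := ‹Nonempty N₂›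
    refine ⟨fun p X Y => ((first (p, b) X Y).1 (h (p, b) X Y)).1, fun x => ?_⟩
    -- Positive dimension supplies a unit vector e; since g₁(e, e) = 1, the alternative g₁(e, e) = 0
    -- is excluded and D ln ρ₂ must vanish.
    refine ((first x _ _).1 (h x (g₁.orthonormalBasis x.1 ⟨0, hn⟩)
      (g₁.orthonormalBasis x.1 ⟨0, hn⟩))).2.resolve_left ?_
    rw [g₁.orthonormalBasis_inner]
    simp
  · exact (first x X Y).2 ⟨h.1 x.1 X Y, Or.inr (h.2 x)⟩
  · obtain ⟨a⟩ := ‹Nonempty N₁›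
    refine ⟨fun q Z W => ((second (a, q) Z W).1 (h (a, q) Z W)).1, fun x => ?_⟩
    refine ((second x _ _).1 (h x (g₂.orthonormalBasis x.2 ⟨0, hn⟩)
      (g₂.orthonormalBasis x.2 ⟨0, hn⟩))).2.resolve_left ?_
    rw [g₂.orthonormalBasis_inner]
    simp
  · exact (second x Z W).2 ⟨h.1 x.2 Z W, Or.inr (h.2 x)⟩
  · exact ⟨fun x X Y => h x _ _, fun x Z W => h x _ _⟩
  · intro x X Y
    obtain ⟨X₁, X₂, rfl⟩ := DWP.exists_tangentPair X
    obtain ⟨Y₁, Y₂, rfl⟩ := DWP.exists_tangentPair Y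
    -- Bilinearity breaks h(X, Y) into two pure terms, zero by assumption, and two mixed ones, zero
    -- for every such φ.
    have split (A : TangentSpace I₁ x.1) (B : TangentSpace I₂ x.2) :
        (DWP.tangentPair A B : TangentSpace (I₁.prod I₂) x) =
          DWP.tangentPair A 0 + DWP.tangentPair 0 B := by
      rw [← DWP.tangentPair_add, add_zero, zero_add]
    rw [← g'.secondFormBilin_apply, split X₁ X₂, split Y₁ Y₂]
    simp only [map_add, LinearMap.add_apply, g'.secondFormBilin_apply]
    have m := DWP.secondForm_prodMap_mixed (g₁' := g₁') (g₂' := g₂') ρ₁ ρ₂ hφ₁ hφ₂ x X₁ Y₂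
    have m' := DWP.secondForm_prodMap_mixed' (g₁' := g₁') (g₂' := g₂') ρ₁ ρ₂ hφ₁ hφ₂ x Y₁ X₂
    rw [h.1 x X₁ Y₁, h.2 x X₂ Y₂, m, m']
    simp
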